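/- **Theorem 2 (Convergence rate).** Fix $k,p,d,d_1,\dots,d_{k+1}\ge 0$, parameter spaces $\Psi\subset\mathbb R^{d}$, $\Theta_j\subset\mathbb R^{d_j}$, and, for $j=1,\dots,k+1$, $\psi\in\Psi$, $\theta_j\in\Theta_j$, probability densities $f_j(\psi,\theta_j;\cdot)$ with respect to Lebesgue measure on $\mathbb R^p$. Let $\psi^0\in\Psi$, $\theta^0_j\in\Theta_j$ be the true parameters, put $f_j^0=f_j(\psi^0,\theta_j^0;\cdot)$, and let $0<\lambda^0_1<\dots<\lambda^0_k<1$ be fixed. For each sample size $n$ in a sequence tending to infinity, let $X_1,\dots,X_n$ be independent, where $X_i$ has density $f_j^0$ for $n^0_{j-1}<i\le n^0_j$, and $0=n^0_0<n^0_1<\dots<n^0_k<n^0_{k+1}=n$ with $n_j^0=n\lambda_j^0$ up to rounding ($|n^0_j-n\lambda^0_j|<1$); the $X_i$ may depend on $n$. Assume: 1. for $j=1,\dots,k$, $f^0_{j+1}\neq f^0_j$ on a set of non-zero Lebesgue measure; 2. (a) $\Psi$ and all $\Theta_j$ are compact; (b) almost surely, for each observation $x$ (from any segment) and each $j$, $f_j(\psi,\theta_j;x)>0$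 for all parameters, and $\log f_j(\psi,\theta_j;x)$ is three times continuously differentiable in $(\psi,\theta_j)\in\Psi\times\Theta_j$; 3. there are constants $C,D$ and exponents $r,r'<2$, not depending on $n$, such that (a) for all $j$ the expectations $E\log f_j(\psi,\theta_j;X_i)$ exist and, for all integers $0\le s<t\le n$, $$E\Bigl\{\max_{\psi\in\Psi,\theta_j\in\Theta_j}\Bigl(\sum_{i=s+1}^{t}\{\log f_j(\psi,\theta_j;X_i)-E[\log f_j(\psi,\theta_j;X_i)]\}\Bigr)^2\Bigr\}\le C(t-s)^r;$$ (b) for all $j$ and all integers $n^0_{j-1}\le s<t\le n^0_j$, $$E\Bigl\{\max_{\psi\in\Psi,\theta_j\in\Theta_j}\Bigl(\sum_{i=s+1}^{t}\Bigl\{\log \frac{f_j(\psi,\theta_j;X_i)}{f_j^0(X_i)}-v_j(\psi,\theta_j)\Bigr\}\Bigr)^2\Bigr\}\le D(t-s)^{r'},\qquad v_j(\psi,\theta_j)=\int \log\frac{f_j(\psi,\theta_j;x)}{f^0_j(x)}\,f^0_j(x)\,dx .$$ Let $(\hat n_1,\dots,\hat n_k,\hat\theta_1,\dots,\hat\theta_{k+1},\hat\psi)$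 almost surely maximize the log-likelihood $\sum_{j=1}^{k+1}\sum_{i=n_{j-1}+1}^{n_j}\log f_j(\psi,\theta_j;X_i)$ over all $0=n_0<n_1<\dots<n_k<n_{k+1}=n$, $\theta_j\in\Theta_j$, $\psi\in\Psi$, and put $\hat\lambda_j=\hat n_j/n$. Then $$\lim_{\delta\to\infty}\limsup_{n\to\infty}P\bigl(n\|\hat\lambda-\lambda^0\|_\infty\ge\delta\bigr)=0,\qquad \|\hat\lambda-\lambda^0\|_\infty=\max_{1\le j\le k}|\hat\lambda_j-\lambda_j^0| .$$ That is, $\hat\lambda_j-\lambda^0_j=O_p(n^{-1})$, and equivalently $\hat n_j-n_j^0=O_p(1)$, for $j=1,\dots,k$. -/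

import Mathlib

open MeasureTheory ProbabilityTheory Filter Topology

noncomputable section

namespace ChangePoint

/-- Column vectors with `m` real entries. -/
abbrev Vec (m : ℕ) : Type := EuclideanSpace ℝ (Fin m)

/-- A parametric change-point model with `k` change points, hence `k + 1` segments, for
observations in `ℝ ^ p`.  The common parameter lives in `Ψ ⊆ ℝ ^ d`, the parameter of segment `j`
in `Θ j ⊆ ℝ ^ (dθ j)`, and `f j ψ θ` is, for all parameters in these spaces, a probability density
with respect to Lebesgue measure.  `ψ₀` and `θ₀` are the true parameters.
Segments are numbered from `0` to `k`. -/
structure Model (k p d : ℕ) (dθ : Fin (k + 1) → ℕ) where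
  /-- parameter space of the common parameter -/
  Ψ : Set (Vec d)
  /-- parameter spaces of the within-segment parameters -/
  Θ : (j : Fin (k + 1)) → Set (Vec (dθ j))
  /-- densities -/
  f : (j : Fin (k + 1)) → Vec d → Vec (dθ j) → Vec p → ℝ
  /-- true common parameter -/
  ψ₀ : Vec d
  /-- true within-segment parameters -/
  θ₀ : (j : Fin (k + 1)) → Vec (dθ j)
  ψ₀_mem : ψ₀ ∈ Ψ
  θ₀_mem : ∀ j, θ₀ j ∈ Θ j
  measurable_f : ∀ j, ∀ ψ ∈ Ψ, ∀ θ ∈ Θ j, Measurable (f j ψ θ)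
  f_nonneg : ∀ j, ∀ ψ ∈ Ψ, ∀ θ ∈ Θ j, ∀ x, 0 ≤ f j ψ θ x
  lintegral_f : ∀ j, ∀ ψ ∈ Ψ, ∀ θ ∈ Θ j, ∫⁻ x, ENNReal.ofReal (f j ψ θ x) = 1

/-- The points `0 = n_0, n_1, …, n_k, n_{k+1} = n` of a change-point configuration. -/
def boundary {k : ℕ} (n : ℕ) (c : Fin k → ℕ) : Fin (k + 2) → ℕ :=
  Fin.cons (α := fun _ => ℕ) 0 (Fin.snoc (α := fun _ => ℕ) c n)

/-- `0 < n_1 < ⋯ < n_k < n`. -/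
def IsConfiguration {k : ℕ} (n : ℕ) (c : Fin k → ℕ) : Prop :=
  StrictMono (boundary n c)

/-- The indices `n_{j-1} + 1, …, n_j` of the observations in a segment. -/
def segment {k : ℕ} (n : ℕ) (c : Fin k → ℕ) (j : Fin (k + 1)) : Finset ℕ :=
  Finset.Ioc (boundary n c j.castSucc) (boundary n c j.succ)

section

variable {k p d : ℕ} {dθ : Fin (k + 1) → ℕ}

/-- The true density of segment `j`. -/
def Model.f₀ (M : Model k p d dθ) (j : Fin (k + 1)) (x : Vec p) : ℝ :=
  M.f j M.ψ₀ (M.θ₀ j) x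

/-- The true distribution of the observations in segment `j`. -/
def Model.law (M : Model k p d dθ) (j : Fin (k + 1)) : Measure (Vec p) :=
  volume.withDensity fun x => ENNReal.ofReal (M.f₀ j x)

/-- The log-likelihood of the observations `x 1, …, x n`. -/
def Model.logLik (M : Model k p d dθ) (n : ℕ) (x : ℕ → Vec p) (c : Fin k → ℕ)
    (ψ : Vec d) (θ : (j : Fin (k + 1)) → Vec (dθ j)) : ℝ :=
  ∑ j, ∑ i ∈ segment n c j, Real.log (M.f j ψ (θ j) (x i))

/-- `(c, ψ, θ)` maximizes the log-likelihood of `x 1, …, x n` over all change-point configurations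
and all parameters. -/
structure Model.IsMLE (M : Model k p d dθ) (n : ℕ) (x : ℕ → Vec p) (c : Fin k → ℕ)
    (ψ : Vec d) (θ : (j : Fin (k + 1)) → Vec (dθ j)) : Prop where
  isConfiguration : IsConfiguration n c
  ψ_mem : ψ ∈ M.Ψ
  θ_mem : ∀ j, θ j ∈ M.Θ j
  logLik_le : ∀ c' ψ' θ', IsConfiguration n c' → ψ' ∈ M.Ψ → (∀ j, θ' j ∈ M.Θ j) →
    M.logLik n x c' ψ' θ' ≤ M.logLik n x c ψ θ

/-- `X 1, …, X n` is a sample of size `n` from the model with true change points `c`: the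
observations are independent and those in segment `j` have density `f₀ j`. -/
structure Model.IsSample (M : Model k p d dθ) {Ω : Type*} [MeasurableSpace Ω] (P : Measure Ω)
    (n : ℕ) (c : Fin k → ℕ) (X : ℕ → Ω → Vec p) : Prop where
  isConfiguration : IsConfiguration n c
  hasLaw : ∀ j, ∀ i ∈ segment n c j, HasLaw (X i) (M.law j) P
  indep : iIndepFun (fun i : Finset.Icc 1 n => X i) P

/-- `v(ψ, θ_j; ψ₀, θ₀_i)`, minus the Kullback-Leibler divergence. -/
def Model.v (M : Model k p d dθ) (i j : Fin (k + 1)) (ψ : Vec d) (θ : Vec (dθ j)) : ℝ :=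
  ∫ x, Real.log (M.f j ψ θ x / M.f₀ i x) * M.f₀ i x

/-- The true densities of any two neighbouring segments differ on a set of non-zero measure. -/
def Model.NeighboursDiffer (M : Model k p d dθ) : Prop :=
  ∀ j : Fin k, volume {x | M.f₀ j.succ x ≠ M.f₀ j.castSucc x} ≠ 0

/-- The parameter spaces are compact. -/
def Model.CompactParameters (M : Model k p d dθ) : Prop :=
  IsCompact M.Ψ ∧ ∀ j, IsCompact (M.Θ j)

/-- Almost surely, for an observation from any segment, the log-likelihood contributions of that
observation are finite (positive densities) and three times continuously differentiable in the
parameters. -/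
def Model.SmoothLogLik (M : Model k p d dθ) : Prop :=
  ∀ i, ∀ᵐ x ∂M.law i, ∀ j,
    (∀ ψ ∈ M.Ψ, ∀ θ ∈ M.Θ j, 0 < M.f j ψ θ x) ∧
      ContDiffOn ℝ 3 (fun φ : Vec d × Vec (dθ j) => Real.log (M.f j φ.1 φ.2 x)) (M.Ψ ×ˢ M.Θ j)

/-- Uniform second-moment bound for centred log-likelihoods of arbitrary blocks of observations,
in samples of sizes `N m`; `C` and `r < 2` do not depend on the sample or on the block. -/
def Model.BlockMoments (M : Model k p d dθ) {Ω : ℕ → Type*} [∀ m, MeasurableSpace (Ω m)]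
    (P : (m : ℕ) → Measure (Ω m)) (N : ℕ → ℕ) (X : (m : ℕ) → ℕ → Ω m → Vec p) : Prop :=
  (∀ m, ∀ i ∈ Finset.Icc 1 (N m), ∀ j, ∀ ψ ∈ M.Ψ, ∀ θ ∈ M.Θ j,
      Integrable (fun ω => Real.log (M.f j ψ θ (X m i ω))) (P m)) ∧
    ∃ C r : ℝ, r < 2 ∧ ∀ m j, ∀ s t : ℕ, s < t → t ≤ N m →
      ∫⁻ ω, (⨆ ψ ∈ M.Ψ, ⨆ θ ∈ M.Θ j, ENNReal.ofReal
          ((∑ i ∈ Finset.Ioc s t, (Real.log (M.f j ψ θ (X m i ω))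
            - ∫ ω', Real.log (M.f j ψ θ (X m i ω')) ∂P m)) ^ 2)) ∂P m
        ≤ ENNReal.ofReal (C * ((t : ℝ) - s) ^ r)

/-- Uniform second-moment bound for centred log-likelihood ratios of blocks of observations inside
one true segment, in samples of sizes `N m` with true change points `n₀ m`; `D` and `r < 2` do not
depend on the sample or on the block. -/
def Model.WithinSegmentMoments (M : Model k p d dθ) {Ω : ℕ → Type*} [∀ m, MeasurableSpace (Ω m)]
    (P : (m : ℕ) → Measure (Ω m)) (N : ℕ → ℕ) (n₀ : ℕ → Fin k → ℕ)
    (X : (m : ℕ) → ℕ → Ω m → Vec p) : Prop :=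
  ∃ D r : ℝ, r < 2 ∧ ∀ m j, ∀ s t : ℕ,
    boundary (N m) (n₀ m) j.castSucc ≤ s → s < t → t ≤ boundary (N m) (n₀ m) j.succ →
      ∫⁻ ω, (⨆ ψ ∈ M.Ψ, ⨆ θ ∈ M.Θ j, ENNReal.ofReal
          ((∑ i ∈ Finset.Ioc s t, ((Real.log (M.f j ψ θ (X m i ω))
            - Real.log (M.f₀ j (X m i ω))) - M.v j j ψ θ)) ^ 2)) ∂P m
        ≤ ENNReal.ofReal (D * ((t : ℝ) - s) ^ r)

end

/-- `Y m = O_p(a m)`: the family `Y m / a m` is bounded in probability, uniformly in `m`. -/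
def IsBigOInProb {Ω : ℕ → Type*} [∀ m, MeasurableSpace (Ω m)] (P : (m : ℕ) → Measure (Ω m))
    (Y : (m : ℕ) → Ω m → ℝ) (a : ℕ → ℝ) : Prop :=
  ∀ ε : ℝ, 0 < ε → ∃ K : ℝ, ∀ m, P m {ω | K * a m < |Y m ω|} ≤ ENNReal.ofReal ε

end ChangePoint

end

/-! Explaining an observation from segment `s` by a density other than the true one loses expected
log-likelihood, namely a Kullback-Leibler divergence, which dominates the squared Hellinger
distance. No density is Hellinger-close to two distinct densities at once. Hence there is `κ > 0`
such that one density used on both sides of a true change point loses at least `κ` per pair of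
observations, whatever the parameters (`Model.exists_separation`).

The noise is controlled uniformly in the parameters. Because the exponent in the moment bound is
below 2, a dyadic maximal inequality shows that, outside an event whose probability bound is free of
the sample size and decays geometrically in `m₀`, every centred block sum that starts or ends at a
true boundary is at most `ε * (length + 2 ^ m₀)` (`exists_blockBound`,
`BlockBound.measure_anchor_le`).

The rest is deterministic (`abs_sub_le_of_fluctuations`) and compares the maximizer with two
competitors. Against the true change points and true parameters, its expected loss is at most a
small multiple of the sample size; so the change points are roughly right and the fitted density of
each segment is close in divergence to the true one. Against the true change points with the fitted
parameters, only the observations between `c q` and `c₀ q` matter: each contributes a drift of at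
most `-κ / 2`, while the noise is at most `2 * ε * (length + 2 ^ m₀)`. Optimality then forces `|c q
- c₀ q| ≤ 2 ^ m₀`. No rate for the fitted parameters is required. -/

namespace ChangePoint

/-! ### Deterministic comparison of change-point configurations -/

section Configurations

variable {k n : ℕ} {c c₀ : Fin k → ℕ}

@[simp] lemma boundary_zero : boundary n c 0 = 0 := rfl

@[simp] lemma boundary_last : boundary n c (Fin.last (k + 1)) = n := by
  rw [← Fin.succ_last]
  simp [boundary, -Fin.succ_last]

lemma boundary_castSucc_succ (q : Fin k) : boundary n c q.castSucc.succ = c q := by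
  simp [boundary]

lemma boundary_succ_castSucc (q : Fin k) : boundary n c q.succ.castSucc = c q := by
  rw [← Fin.succ_castSucc, boundary_castSucc_succ]

lemma IsConfiguration.boundary_le (h : IsConfiguration n c) (J : Fin (k + 2)) :
    boundary n c J ≤ n := by
  simpa using h.monotone (Fin.le_last J)

lemma IsConfiguration.apply_le (h : IsConfiguration n c) (q : Fin k) : c q ≤ n := by
  simpa [boundary_castSucc_succ] using h.boundary_le q.castSucc.succ

lemma IsConfiguration.apply_pos (h : IsConfiguration n c) (q : Fin k) : 0 < c q := by
  simpa [boundary_castSucc_succ] using h (Fin.succ_pos q.castSucc)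

lemma IsConfiguration.strictMono (h : IsConfiguration n c) : StrictMono c := by
  intro q q' hq
  have := h (a := q.castSucc.succ) (b := q'.castSucc.succ) (by simpa using hq)
  simpa only [boundary_castSucc_succ] using this

lemma IsConfiguration.pos (h : IsConfiguration n c) : 0 < n := by
  simpa using h (Fin.last_pos : (0 : Fin (k + 2)) < Fin.last (k + 1))

lemma segment_subset (h : IsConfiguration n c) (j : Fin (k + 1)) :
    segment n c j ⊆ Finset.Ioc 0 n :=
  Finset.Ioc_subset_Ioc (Nat.zero_le _) (h.boundary_le _)

lemma segment_nonempty (h : IsConfiguration n c) (j : Fin (k + 1)) : (segment n c j).Nonempty :=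
  Finset.nonempty_Ioc.2 (h j.castSucc_lt_succ)

/-- The segments of a configuration cover the observations. -/
lemma exists_mem_segment (c : Fin k → ℕ) {i : ℕ} (hi : i ∈ Finset.Ioc 0 n) :
    ∃ j, i ∈ segment n c j := by
  by_contra! hne
  have key : ∀ J : Fin (k + 2), boundary n c J < i := by
    intro J
    induction J using Fin.induction with
    | zero => simpa using (Finset.mem_Ioc.1 hi).1
    | succ j ih =>
      by_contra! hle
      exact hne j (Finset.mem_Ioc.2 ⟨ih, hle⟩)
  have := key (Fin.last _)
  rw [boundary_last] at this
  exact absurd (Finset.mem_Ioc.1 hi).2 (not_le.2 this)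

lemma sum_Ioc_eq_sub {s t : ℕ} (h : s ≤ t) (g : ℕ → ℝ) :
    ∑ i ∈ Finset.Ioc s t, g i = ∑ i ∈ Finset.Ioc 0 t, g i - ∑ i ∈ Finset.Ioc 0 s, g i := by
  have hu : Finset.Ioc 0 t = Finset.Ioc 0 s ∪ Finset.Ioc s t :=
    (Finset.Ioc_union_Ioc_eq_Ioc (Nat.zero_le s) h).symm
  have hd : Disjoint (Finset.Ioc 0 s) (Finset.Ioc s t) := by
    rw [Finset.disjoint_left]
    intro i hi hi'
    simp only [Finset.mem_Ioc] at hi hi'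
    omega
  rw [hu, Finset.sum_union hd]
  ring

lemma sum_segment (h : IsConfiguration n c) (j : Fin (k + 1)) (g : ℕ → ℝ) :
    ∑ i ∈ segment n c j, g i = ∑ i ∈ Finset.Ioc 0 (boundary n c j.succ), g i
      - ∑ i ∈ Finset.Ioc 0 (boundary n c j.castSucc), g i :=
  sum_Ioc_eq_sub (h.monotone j.castSucc_lt_succ.le) g

/-- Summation by parts over the segments of a configuration. -/
lemma sum_sum_segment (h : IsConfiguration n c) (g : Fin (k + 1) → ℕ → ℝ) :
    ∑ j, ∑ i ∈ segment n c j, g j i = ∑ i ∈ Finset.Ioc 0 n, g (Fin.last k) i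
      + ∑ q : Fin k, ∑ i ∈ Finset.Ioc 0 (c q), (g q.castSucc i - g q.succ i) := by
  simp only [sum_segment h, Finset.sum_sub_distrib]
  rw [Fin.sum_univ_castSucc, Fin.sum_univ_succ (fun j : Fin (k + 1) =>
    ∑ i ∈ Finset.Ioc 0 (boundary n c j.castSucc), g j i)]
  simp only [boundary_castSucc_succ, boundary_succ_castSucc, Fin.succ_last, boundary_last,
    Fin.castSucc_zero, boundary_zero, Finset.Ioc_self, Finset.sum_empty]
  ring

lemma sum_sum_segment_const (h : IsConfiguration n c) (g : ℕ → ℝ) :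
    ∑ j, ∑ i ∈ segment n c j, g i = ∑ i ∈ Finset.Ioc 0 n, g i := by
  simp [sum_sum_segment h (fun _ => g)]

lemma strictMono_fin_eq_id {g : Fin k → Fin k} (hg : StrictMono g) (q : Fin k) : g q = q :=
  le_antisymm hg.apply_le hg.le_apply

/-- Two configurations are close as soon as every change point of a well-separated one is close to
some change point of the other one. -/
lemma IsConfiguration.close_of_forall_exists (hc : IsConfiguration n c)
    (hc₀ : IsConfiguration n c₀) {R : ℕ}
    (hgap : ∀ j : Fin (k + 1), boundary n c₀ j.castSucc + 3 * R ≤ boundary n c₀ j.succ)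
    (h : ∀ q, ∃ q', c q' < c₀ q + R ∧ c₀ q < c q' + R) (q : Fin k) :
    c q < c₀ q + R ∧ c₀ q < c q + R := by
  choose g hg using h
  -- True change points are at least `3 * R` apart and each moves by less than `R`, so their order
  -- is kept; a strictly monotone self-map of `Fin k` is the identity.
  have hmono : StrictMono g := by
    intro q q' hq
    have h1 : c₀ q + 3 * R ≤ c₀ q' := by
      have h2 := hgap q'.castSucc
      rw [boundary_castSucc_succ] at h2
      have h3 : c₀ q ≤ boundary n c₀ q'.castSucc.castSucc := by
        rw [← boundary_castSucc_succ (n := n) (c := c₀) q]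
        apply hc₀.monotone
        rw [Fin.le_def]
        simpa using hq
      omega
    have h4 := hg q
    have h5 := hg q'
    exact hc.strictMono.lt_iff_lt.1 (by omega)
  have := hg q
  rwa [strictMono_fin_eq_id hmono q] at this

/-- If the cost `h s j ≥ 0` of assigning an observation from the true segment `s` to the segment `j`
satisfies `h s j + h s' j ≥ κ` for neighbouring `s`, `s'`, then an assignment of small total cost
has all its change points close to the true ones and `h j j` small. -/
lemma close_of_cost_le (hc : IsConfiguration n c) (hc₀ : IsConfiguration n c₀) {R : ℕ} (hR : 0 < R)
    (hgap : ∀ j : Fin (k + 1), boundary n c₀ j.castSucc + 3 * R ≤ boundary n c₀ j.succ)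
    {h : Fin (k + 1) → Fin (k + 1) → ℝ} (h_nonneg : ∀ s j, 0 ≤ h s j) {κ : ℝ} (hκ : 0 < κ)
    (hsep : ∀ (q : Fin k) j, κ ≤ h q.castSucc j + h q.succ j)
    {H : Fin (k + 1) → ℕ → ℝ} (hH : ∀ j s, ∀ i ∈ segment n c₀ s, H j i = h s j)
    (hcost : ∑ j, ∑ i ∈ segment n c j, H j i ≤ κ / 8 * R) :
    (∀ q, c q < c₀ q + R ∧ c₀ q < c q + R) ∧ ∀ j, h j j ≤ κ / 8 := by
  have hR' : (0 : ℝ) < R := by exact_mod_cast hR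
  have H_nonneg : ∀ j, ∀ i ∈ Finset.Ioc 0 n, 0 ≤ H j i := by
    intro j i hi
    obtain ⟨s, hs⟩ := exists_mem_segment c₀ hi
    rw [hH j s i hs]
    exact h_nonneg s j
  have hcost_seg : ∀ j, ∀ T ⊆ segment n c j, ∑ i ∈ T, H j i ≤ κ / 8 * R := by
    intro j T hT
    calc ∑ i ∈ T, H j i ≤ ∑ i ∈ segment n c j, H j i :=
          Finset.sum_le_sum_of_subset_of_nonneg hT
            fun i hi _ => H_nonneg j i (segment_subset hc j hi)
      _ ≤ ∑ j, ∑ i ∈ segment n c j, H j i :=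
          Finset.single_le_sum (f := fun j => ∑ i ∈ segment n c j, H j i)
            (fun j _ => Finset.sum_nonneg fun i hi => H_nonneg j i (segment_subset hc j hi))
            (Finset.mem_univ j)
      _ ≤ _ := hcost
  have hclose : ∀ q, c q < c₀ q + R ∧ c₀ q < c q + R := by
    refine hc.close_of_forall_exists hc₀ hgap fun q => ?_
    -- Otherwise the window of radius `R` around `c₀ q` lies in a single estimated segment `j`. It
    -- holds `R` observations from each of two neighbouring true segments, at a total cost of at
    -- least `κ * R`.
    by_contra! hfar
    have g1 := hgap q.castSucc
    have g2 := hgap q.succ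
    rw [boundary_castSucc_succ] at g1
    rw [boundary_succ_castSucc] at g2
    have hle := hc₀.boundary_le q.succ.succ
    have hfar' : ∀ J : Fin (k + 2), boundary n c J < c₀ q + R → boundary n c J + R ≤ c₀ q := by
      intro J
      refine Fin.cases ?_ (fun J => ?_) J
      · simp only [boundary_zero]; omega
      · refine Fin.lastCases ?_ (fun J => ?_) J
        · rw [Fin.succ_last, boundary_last]; omega
        · rw [boundary_castSucc_succ]; exact hfar J
    obtain ⟨j, hj⟩ := exists_mem_segment c (n := n) (i := c₀ q)
      (Finset.mem_Ioc.2 ⟨hc₀.apply_pos q, hc₀.apply_le q⟩)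
    obtain ⟨hj1, hj2⟩ := Finset.mem_Ioc.1 hj
    have b1 := hfar' _ (hj1.trans_le (Nat.le_add_right _ R))
    have b2 : c₀ q + R ≤ boundary n c j.succ := by
      by_contra! hlt
      have := hfar' _ hlt
      omega
    have hcst := hcost_seg j (Finset.Ioc (c₀ q - R) (c₀ q + R))
      (Finset.Ioc_subset_Ioc (by omega) b2)
    rw [← Finset.sum_sdiff (s₁ := Finset.Ioc (c₀ q) (c₀ q + R))
      (Finset.Ioc_subset_Ioc (by omega) le_rfl)] at hcst
    have e1 : Finset.Ioc (c₀ q - R) (c₀ q + R) \ Finset.Ioc (c₀ q) (c₀ q + R)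
        = Finset.Ioc (c₀ q - R) (c₀ q) := by
      ext i
      simp only [Finset.mem_sdiff, Finset.mem_Ioc]
      omega
    have s1 : ∑ i ∈ Finset.Ioc (c₀ q - R) (c₀ q), H j i = R * h q.castSucc j := by
      rw [Finset.sum_congr rfl (fun i hi => hH j q.castSucc i ?_)]
      · rw [Finset.sum_const, Nat.card_Ioc, nsmul_eq_mul]
        congr 2
        omega
      · simp only [segment, Finset.mem_Ioc, boundary_castSucc_succ] at hi ⊢
        omega
    have s2 : ∑ i ∈ Finset.Ioc (c₀ q) (c₀ q + R), H j i = R * h q.succ j := by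
      rw [Finset.sum_congr rfl (fun i hi => hH j q.succ i ?_)]
      · rw [Finset.sum_const, Nat.card_Ioc, nsmul_eq_mul]
        congr 2
        omega
      · simp only [segment, Finset.mem_Ioc, boundary_succ_castSucc] at hi ⊢
        omega
    rw [e1, s1, s2] at hcst
    nlinarith [hsep q j]
  refine ⟨hclose, fun j => ?_⟩
  have g := hgap j
  have b1 : boundary n c j.castSucc ≤ boundary n c₀ j.castSucc + R := by
    refine Fin.cases ?_ (fun q => ?_) j
    · simp
    · rw [boundary_succ_castSucc, boundary_succ_castSucc]; exact (hclose q).1.le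
  have b2 : boundary n c₀ j.succ ≤ boundary n c j.succ + R := by
    refine Fin.lastCases ?_ (fun q => ?_) j
    · simp
    · rw [boundary_castSucc_succ, boundary_castSucc_succ]; exact (hclose q).2.le
  -- As the boundaries move by at most `R`, these `R` observations, taken at distance `R` from both
  -- ends of the true segment `j`, are also in the estimated segment `j`. This is why the gaps are
  -- `3 * R`.
  have hcst := hcost_seg j (Finset.Ioc (boundary n c₀ j.castSucc + R)
    (boundary n c₀ j.castSucc + R + R)) (Finset.Ioc_subset_Ioc b1 (by omega))
  rw [Finset.sum_congr rfl (fun i hi => hH j j i ?_)] at hcst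
  · rw [Finset.sum_const, Nat.card_Ioc, nsmul_eq_mul] at hcst
    rw [show boundary n c₀ j.castSucc + R + R - (boundary n c₀ j.castSucc + R) = R by omega] at hcst
    nlinarith
  · simp only [segment, Finset.mem_Ioc] at hi ⊢
    omega

lemma abs_sum_segment_le (hc : IsConfiguration n c) {g : ℕ → ℝ} {U : ℝ}
    (hg : ∀ t ≤ n, |∑ i ∈ Finset.Ioc 0 t, g i| ≤ U) (j : Fin (k + 1)) :
    |∑ i ∈ segment n c j, g i| ≤ 2 * U := by
  rw [sum_segment hc]
  have h1 := hg _ (hc.boundary_le j.succ)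
  have h2 := hg _ (hc.boundary_le j.castSucc)
  rw [abs_le] at *
  constructor <;> linarith

/-- Deterministic core of the rate of convergence.  Here `a j i` and `b j i` are the log-likelihood
contributions of observation `i` to segment `j` at the estimated and at the true parameters, `Ea`
and `Eb` their expectations, which only depend on the true segment of `i`. -/
theorem abs_sub_le_of_fluctuations (hc : IsConfiguration n c) (hc₀ : IsConfiguration n c₀)
    {R : ℕ} (hR : 0 < R)
    (hgap : ∀ j : Fin (k + 1), boundary n c₀ j.castSucc + 3 * R ≤ boundary n c₀ j.succ)
    {a b Ea Eb : Fin (k + 1) → ℕ → ℝ} {A : Fin (k + 1) → Fin (k + 1) → ℝ} {B : Fin (k + 1) → ℝ}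
    (hEa : ∀ j s, ∀ i ∈ segment n c₀ s, Ea j i = A s j)
    (hEb : ∀ s, ∀ i ∈ segment n c₀ s, Eb s i = B s)
    {κ ε δ U : ℝ} (hκ : 0 < κ) (hδ : 0 ≤ δ) (hε : ε * (8 * (k + 1)) ≤ κ)
    (hU : 4 * (k + 1) * U ≤ κ / 8 * R)
    (hAB : ∀ s j, A s j ≤ B s)
    (hsep : ∀ (q : Fin k) j,
      κ ≤ (B q.castSucc - A q.castSucc j) + (B q.succ - A q.succ j))
    (ha : ∀ j, ∀ t ≤ n, |∑ i ∈ Finset.Ioc 0 t, (a j i - Ea j i)| ≤ U)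
    (hb : ∀ j, ∀ t ≤ n, |∑ i ∈ Finset.Ioc 0 t, (b j i - Eb j i)| ≤ U)
    (hright : ∀ j q t, c₀ q ≤ t → t ≤ n →
      |∑ i ∈ Finset.Ioc (c₀ q) t, (a j i - Ea j i)| ≤ ε * ((t : ℝ) - c₀ q + δ))
    (hleft : ∀ j q t, t ≤ c₀ q →
      |∑ i ∈ Finset.Ioc t (c₀ q), (a j i - Ea j i)| ≤ ε * ((c₀ q : ℝ) - t + δ))
    (hopt : ∑ j, ∑ i ∈ segment n c₀ j, b j i ≤ ∑ j, ∑ i ∈ segment n c j, a j i)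
    (hopt' : ∑ j, ∑ i ∈ segment n c₀ j, a j i ≤ ∑ j, ∑ i ∈ segment n c j, a j i)
    (q : Fin k) : |(c q : ℝ) - c₀ q| ≤ δ := by
  choose! s hs using fun i (hi : i ∈ Finset.Ioc 0 n) => exists_mem_segment c₀ hi
  have hs_eq : ∀ j, ∀ i ∈ segment n c₀ j, B (s i) = B j := by
    intro j i hi
    have h1 := hs i (segment_subset hc₀ j hi)
    have h2 : s i = j := by
      simp only [segment, Finset.mem_Ioc] at h1 hi
      rcases lt_trichotomy (s i) j with hlt | heq | hlt
      · have := hc₀.monotone (Fin.succ_le_castSucc_iff.2 hlt)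
        omega
      · exact heq
      · have := hc₀.monotone (Fin.succ_le_castSucc_iff.2 hlt)
        omega
    rw [h2]
  -- Comparison with the truth: replacing `a` and `b` by their means costs `2 * U` per segment each,
  -- hence `4 * (k + 1) * U` in all.
  have hcost : ∑ j, ∑ i ∈ segment n c j, (B (s i) - Ea j i) ≤ κ / 8 * R := by
    have e1 : ∑ j, ∑ i ∈ segment n c j, B (s i) = ∑ j, ∑ i ∈ segment n c₀ j, Eb j i := by
      rw [sum_sum_segment_const hc, ← sum_sum_segment_const hc₀]
      refine Finset.sum_congr rfl fun j _ => Finset.sum_congr rfl fun i hi => ?_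
      rw [hs_eq j i hi, hEb j i hi]
    have e2 : ∑ j, ∑ i ∈ segment n c j, a j i - ∑ j, ∑ i ∈ segment n c j, Ea j i
        ≤ ∑ _j : Fin (k + 1), 2 * U := by
      rw [← Finset.sum_sub_distrib]
      refine Finset.sum_le_sum fun j _ => ?_
      rw [← Finset.sum_sub_distrib]
      exact (le_abs_self _).trans (abs_sum_segment_le hc (ha j) j)
    have e3 : ∑ j, ∑ i ∈ segment n c₀ j, Eb j i - ∑ j, ∑ i ∈ segment n c₀ j, b j i
        ≤ ∑ _j : Fin (k + 1), 2 * U := by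
      rw [← Finset.sum_sub_distrib]
      refine Finset.sum_le_sum fun j _ => ?_
      rw [← Finset.sum_sub_distrib]
      have h1 := neg_abs_le (∑ i ∈ segment n c₀ j, (b j i - Eb j i))
      have h2 := abs_sum_segment_le hc₀ (hb j) j
      rw [Finset.sum_sub_distrib] at h1 h2 ⊢
      linarith
    simp only [Finset.sum_const, Finset.card_univ, Fintype.card_fin, nsmul_eq_mul] at e2 e3
    push_cast at e2 e3
    simp only [Finset.sum_sub_distrib]
    rw [e1]
    linarith
  obtain ⟨hclose, hdiag⟩ := close_of_cost_le hc hc₀ hR hgap (h := fun s j => B s - A s j)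
    (fun s j => sub_nonneg.2 (hAB s j)) hκ hsep
    (fun j s' i hi => by rw [hs_eq s' i hi, hEa j s' i hi]) hcost
  -- The observations between `c q` and `c₀ q` come from one true segment. There the right fit loses
  -- at most `κ / 8` by `hdiag`, and the wrong one at least `7 * κ / 8` by `hsep`; of the drift `3 *
  -- κ / 4` only `κ / 2` is kept.
  have hincr : ∀ q : Fin k, ∑ i ∈ Finset.Ioc 0 (c q), (a q.castSucc i - a q.succ i)
      - ∑ i ∈ Finset.Ioc 0 (c₀ q), (a q.castSucc i - a q.succ i)
      ≤ -(κ / 2) * |(c q : ℝ) - c₀ q| + 2 * ε * (|(c q : ℝ) - c₀ q| + δ) := by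
    intro q
    have g1 := hgap q.castSucc
    have g2 := hgap q.succ
    rw [boundary_castSucc_succ] at g1
    rw [boundary_succ_castSucc] at g2
    obtain ⟨c1, c2⟩ := hclose q
    have d1 := hdiag q.castSucc
    have d2 := hdiag q.succ
    have h1 := hsep q q.castSucc
    have h2 := hsep q q.succ
    rcases le_total (c₀ q) (c q) with hle | hle
    · have hle' : (c₀ q : ℝ) ≤ c q := by exact_mod_cast hle
      rw [← sum_Ioc_eq_sub hle, abs_of_nonneg (sub_nonneg.2 hle')]
      have f1 := (abs_le.1 (hright q.castSucc q (c q) hle (hc.apply_le q))).2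
      have f2 := (abs_le.1 (hright q.succ q (c q) hle (hc.apply_le q))).1
      have m : ∀ j, ∑ i ∈ Finset.Ioc (c₀ q) (c q), Ea j i = ((c q : ℝ) - c₀ q) * A q.succ j := by
        intro j
        rw [Finset.sum_congr rfl (fun i hi => hEa j q.succ i ?_)]
        · rw [Finset.sum_const, Nat.card_Ioc, nsmul_eq_mul, Nat.cast_sub hle]
        · simp only [segment, Finset.mem_Ioc, boundary_succ_castSucc] at hi ⊢
          omega
      rw [Finset.sum_sub_distrib, m] at f1 f2
      rw [Finset.sum_sub_distrib]
      nlinarith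
    · have hle' : (c q : ℝ) ≤ c₀ q := by exact_mod_cast hle
      rw [← neg_sub, ← sum_Ioc_eq_sub hle, abs_of_nonpos (sub_nonpos.2 hle')]
      have f1 := (abs_le.1 (hleft q.castSucc q (c q) hle)).1
      have f2 := (abs_le.1 (hleft q.succ q (c q) hle)).2
      have m : ∀ j, ∑ i ∈ Finset.Ioc (c q) (c₀ q), Ea j i
          = ((c₀ q : ℝ) - c q) * A q.castSucc j := by
        intro j
        rw [Finset.sum_congr rfl (fun i hi => hEa j q.castSucc i ?_)]
        · rw [Finset.sum_const, Nat.card_Ioc, nsmul_eq_mul, Nat.cast_sub hle]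
        · simp only [segment, Finset.mem_Ioc, boundary_castSucc_succ] at hi ⊢
          omega
      rw [Finset.sum_sub_distrib, m] at f1 f2
      rw [Finset.sum_sub_distrib]
      nlinarith
  rw [sum_sum_segment hc₀, sum_sum_segment hc] at hopt'
  have htotal := Finset.sum_le_sum fun q (_ : q ∈ Finset.univ) => hincr q
  have hk : (0 : ℝ) ≤ k := Nat.cast_nonneg k
  -- The factor `k + 1` in the choice of `ε` keeps the sum of the `k` error terms in `δ` below `κ /
  -- 4 * δ`.
  have hterm : ∀ q : Fin k, -(κ / 2) * |(c q : ℝ) - c₀ q| + 2 * ε * (|(c q : ℝ) - c₀ q| + δ)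
      ≤ -(κ / 4) * |(c q : ℝ) - c₀ q| + κ / (4 * (k + 1)) * δ := by
    intro q
    have h1 : 2 * ε ≤ κ / (4 * (k + 1)) := by
      rw [le_div_iff₀ (by positivity)]
      linarith
    have h2 : κ / (4 * (k + 1)) ≤ κ / 4 := by
      apply div_le_div_of_nonneg_left hκ.le (by norm_num)
      linarith
    have h3 := abs_nonneg ((c q : ℝ) - c₀ q)
    nlinarith
  have htotal' := htotal.trans (Finset.sum_le_sum fun q (_ : q ∈ Finset.univ) => hterm q)
  rw [Finset.sum_sub_distrib, Finset.sum_add_distrib, ← Finset.mul_sum, Finset.sum_const,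
    Finset.card_univ, Fintype.card_fin, nsmul_eq_mul] at htotal'
  have hsingle : |(c q : ℝ) - c₀ q| ≤ ∑ q, |(c q : ℝ) - c₀ q| :=
    Finset.single_le_sum (f := fun q => |(c q : ℝ) - c₀ q|) (fun _ _ => abs_nonneg _)
      (Finset.mem_univ q)
  have hlast : (k : ℝ) * (κ / (4 * (k + 1)) * δ) ≤ κ / 4 * δ := by
    have : (k : ℝ) * (κ / (4 * (k + 1)) * δ) = k / (k + 1) * (κ / 4 * δ) := by
      field_simp
    rw [this]
    refine mul_le_of_le_one_left (by positivity) ?_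
    rw [div_le_one (by positivity)]
    linarith
  have : κ / 4 * |(c q : ℝ) - c₀ q| ≤ κ / 4 * δ := by nlinarith
  exact le_of_mul_le_mul_left this (by positivity)

end Configurations

end ChangePoint

namespace ChangePoint

/-! ### Maximal inequalities from second moments of blocks -/

section Maximal

open scoped ENNReal

variable {Ω : Type*} [MeasurableSpace Ω]

/-- A dyadic upper bound for `max_{l ≤ 2 ^ m} G a (a + l)`. -/
noncomputable def dyadicMax (G : ℕ → ℕ → Ω → ℝ≥0∞) : ℕ → ℕ → Ω → ℝ≥0∞
  | 0, a => G a (a + 1)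
  | m + 1, a => fun ω =>
      max (dyadicMax G m a ω) (G a (a + 2 ^ m) ω + dyadicMax G m (a + 2 ^ m) ω)

/-- A family of functions of blocks `(s, t]` which is subadditive and whose second moments grow at
most like the power `r` of the length of the block. -/
structure BlockBound (P : Measure Ω) (C : ℝ≥0∞) (r : ℝ) (G : ℕ → ℕ → Ω → ℝ≥0∞) : Prop where
  aemeasurable : ∀ s t, AEMeasurable (G s t) P
  self : ∀ s ω, G s s ω = 0
  subadd : ∀ s t u ω, s ≤ t → t ≤ u → G s u ω ≤ G s t ω + G t u ω
  moment : ∀ s l : ℕ, ∫⁻ ω, G s (s + l) ω ^ 2 ∂P ≤ C * (l : ℝ≥0∞) ^ r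

variable {P : Measure Ω} {C : ℝ≥0∞} {r : ℝ} {G : ℕ → ℕ → Ω → ℝ≥0∞}

lemma BlockBound.aemeasurable_dyadicMax (h : BlockBound P C r G) (m a : ℕ) :
    AEMeasurable (dyadicMax G m a) P := by
  induction m generalizing a with
  | zero => exact h.aemeasurable _ _
  | succ m ih => exact (ih a).max ((h.aemeasurable _ _).add (ih _))

lemma BlockBound.le_dyadicMax (h : BlockBound P C r G) (m a : ℕ) {l : ℕ} (hl : l ≤ 2 ^ m)
    (ω : Ω) : G a (a + l) ω ≤ dyadicMax G m a ω := by
  induction m generalizing a l with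
  | zero =>
    have : l = 0 ∨ l = 1 := by simp at hl; omega
    rcases this with rfl | rfl
    · simp [h.self]
    · exact le_rfl
  | succ m ih =>
    rcases le_total l (2 ^ m) with hle | hle
    · exact (ih a hle).trans (le_max_left _ _)
    · refine le_trans ?_ (le_max_right _ _)
      refine (h.subadd a (a + 2 ^ m) (a + l) ω (by omega) (by omega)).trans ?_
      gcongr
      have := ih (a + 2 ^ m) (l := l - 2 ^ m) (by rw [pow_succ] at hl; omega)
      rwa [show a + 2 ^ m + (l - 2 ^ m) = a + l by omega] at this

/-- This is `(2 * a - b) ^ 2 ≥ 0`. The unequal weights let the dyadic recursion multiply the second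
moment by only `1 + 3 / 2 < 2 ^ (3 / 2)`; equal weights would give 3. -/
lemma add_sq_le_ennreal (a b : ℝ≥0∞) : (a + b) ^ 2 ≤ 3 * a ^ 2 + 3 / 2 * b ^ 2 := by
  induction a with
  | top => simp [ENNReal.mul_top]
  | coe a =>
    induction b with
    | top => simp [ENNReal.mul_top]
    | coe b =>
      have h : ((3 / 2 : NNReal) : ℝ≥0∞) = 3 / 2 := by
        rw [ENNReal.coe_div (by norm_num)]; norm_num
      rw [← h]
      norm_cast
      rw [← NNReal.coe_le_coe]
      push_cast
      nlinarith [sq_nonneg (2 * (a : ℝ) - b)]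

/-- **Maximal inequality** for subadditive families. -/
lemma BlockBound.lintegral_dyadicMax_sq_le (h : BlockBound P C r G) (hr : 3 / 2 ≤ r) (m a : ℕ) :
    ∫⁻ ω, dyadicMax G m a ω ^ 2 ∂P ≤ 10 * C * ((2 : ℝ≥0∞) ^ r) ^ m := by
  induction m generalizing a with
  | zero =>
    refine (h.moment a 1).trans ?_
    simp only [Nat.cast_one, ENNReal.one_rpow, mul_one, pow_zero]
    exact le_mul_of_one_le_left zero_le (by norm_num)
  | succ m ih =>
    set x : ℝ≥0∞ := (2 : ℝ≥0∞) ^ r with hx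
    -- The constant 10 closes the recursion: `10 * (1 + 3 / 2) + 3 = 28`. The requirement `2 ^ r ≥
    -- 2.8` is what `3 / 2 ≤ r` provides.
    have hx28 : 28 ≤ 10 * x := by
      have h1 : (2.8 : ℝ) ≤ 2 ^ r := by
        calc (2.8 : ℝ) ≤ 2 ^ (3 / 2 : ℝ) := by
              rw [show (3 / 2 : ℝ) = 1 + 1 / 2 by norm_num, Real.rpow_add (by norm_num),
                Real.rpow_one, ← Real.sqrt_eq_rpow]
              have : (1.4 : ℝ) ≤ √2 := Real.le_sqrt_of_sq_le (by norm_num)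
              linarith
          _ ≤ 2 ^ r := Real.rpow_le_rpow_of_exponent_le (by norm_num) hr
      have h2 : x = ENNReal.ofReal (2 ^ r) := by
        rw [hx, ← ENNReal.ofReal_rpow_of_pos (by norm_num)]
        simp
      rw [h2, show (28 : ℝ≥0∞) = ENNReal.ofReal 28 by simp,
        show (10 : ℝ≥0∞) = ENNReal.ofReal 10 by simp, ← ENNReal.ofReal_mul (by norm_num)]
      exact ENNReal.ofReal_le_ofReal (by linarith)
    have hG : ∫⁻ ω, G a (a + 2 ^ m) ω ^ 2 ∂P ≤ C * x ^ m := by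
      refine (h.moment a (2 ^ m)).trans_eq ?_
      rw [hx]
      push_cast
      rw [← ENNReal.rpow_natCast, ← ENNReal.rpow_mul, ← ENNReal.rpow_natCast (2 ^ r),
        ← ENNReal.rpow_mul, mul_comm r]
    have hmeas := h.aemeasurable_dyadicMax m
    calc ∫⁻ ω, dyadicMax G (m + 1) a ω ^ 2 ∂P
        ≤ ∫⁻ ω, (dyadicMax G m a ω ^ 2 + (3 * G a (a + 2 ^ m) ω ^ 2
            + 3 / 2 * dyadicMax G m (a + 2 ^ m) ω ^ 2)) ∂P := by
          refine lintegral_mono fun ω => ?_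
          simp only [dyadicMax]
          rcases max_choice (dyadicMax G m a ω)
            (G a (a + 2 ^ m) ω + dyadicMax G m (a + 2 ^ m) ω) with h' | h' <;> rw [h']
          · exact le_self_add
          · exact (add_sq_le_ennreal _ _).trans le_add_self
      _ = ∫⁻ ω, dyadicMax G m a ω ^ 2 ∂P + (3 * ∫⁻ ω, G a (a + 2 ^ m) ω ^ 2 ∂P
            + 3 / 2 * ∫⁻ ω, dyadicMax G m (a + 2 ^ m) ω ^ 2 ∂P) := by
          rw [lintegral_add_left' ((hmeas a).pow_const 2),
            lintegral_add_left' (((h.aemeasurable _ _).pow_const 2).const_mul 3),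
            lintegral_const_mul'' _ ((h.aemeasurable _ _).pow_const 2),
            lintegral_const_mul'' _ ((hmeas _).pow_const 2)]
      _ ≤ 10 * C * x ^ m + (3 * (C * x ^ m) + 3 / 2 * (10 * C * x ^ m)) := by
          gcongr
          · exact ih a
          · exact ih _
      _ = 28 * (C * x ^ m) := by
          have : (3 / 2 : ℝ≥0∞) * 10 = 15 := by
            rw [show (10 : ℝ≥0∞) = 2 * 5 by norm_num, ← mul_assoc,
              ENNReal.div_mul_cancel (by norm_num) (by norm_num)]
            norm_num
          rw [show (3 / 2 : ℝ≥0∞) * (10 * C * x ^ m) = (3 / 2 * 10) * (C * x ^ m) by ring, this]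
          ring
      _ ≤ 10 * x * (C * x ^ m) := by gcongr
      _ = 10 * C * x ^ (m + 1) := by ring

/-- The first scale `2 ^ (m₀ + m)` reaching `l` is at most `2 * (l + 2 ^ m₀)`, so a violation at any
length shows up in the dyadic maximum at that scale, up to a factor 2. A union bound over scales is
then affordable. -/
lemma BlockBound.exists_of_gt (h : BlockBound P C r G) {ε : ℝ≥0∞} {m₀ l : ℕ} {ω : Ω}
    (hl : ε * (l + 2 ^ m₀) < G 0 l ω) :
    ∃ m, ε * 2 ^ (m₀ + m) ≤ 2 * dyadicMax G (m₀ + m) 0 ω := by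
  obtain ⟨m, hm1, hm2⟩ : ∃ m, l ≤ 2 ^ (m₀ + m) ∧ 2 ^ (m₀ + m) ≤ 2 * (l + 2 ^ m₀) := by
    have hex : ∃ m, l ≤ 2 ^ (m₀ + m) :=
      ⟨l, (Nat.lt_two_pow_self.le).trans (Nat.pow_le_pow_right (by norm_num) (by omega))⟩
    refine ⟨Nat.find hex, Nat.find_spec hex, ?_⟩
    rcases Nat.eq_zero_or_pos (Nat.find hex) with h0 | hpos
    · rw [h0, add_zero]; omega
    · have := Nat.find_min hex (m := Nat.find hex - 1) (by omega)
      rw [show m₀ + Nat.find hex = (m₀ + (Nat.find hex - 1)) + 1 by omega, pow_succ]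
      linarith [Nat.zero_le (2 ^ m₀), not_le.1 this]
  refine ⟨m, ?_⟩
  have h1 : G 0 l ω ≤ dyadicMax G (m₀ + m) 0 ω := by
    simpa using h.le_dyadicMax (m₀ + m) 0 hm1 ω
  calc ε * 2 ^ (m₀ + m) ≤ ε * (2 * (l + 2 ^ m₀)) := by
        gcongr
        exact_mod_cast hm2
    _ = 2 * (ε * (l + 2 ^ m₀)) := by ring
    _ ≤ 2 * dyadicMax G (m₀ + m) 0 ω := by gcongr; exact hl.le.trans h1

/-- **Hájek–Rényi type inequality** for subadditive families. -/
lemma BlockBound.measure_exists_gt_le (h : BlockBound P C r G) (hr : 3 / 2 ≤ r) {ε : ℝ≥0∞}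
    (hε : ε ≠ 0) (hε' : ε ≠ ∞) (m₀ : ℕ) :
    P {ω | ∃ l : ℕ, ε * (l + 2 ^ m₀) < G 0 l ω}
      ≤ 40 * C / ε ^ 2 * (1 - 2 ^ r / 4)⁻¹ * (2 ^ r / 4) ^ m₀ := by
  -- Markov's inequality: the second moment grows like `(2 ^ r) ^ m` and the squared threshold like
  -- `4 ^ m`.
  have hstep : ∀ m, P {ω | ε * 2 ^ m ≤ 2 * dyadicMax G m 0 ω}
      ≤ 40 * C / ε ^ 2 * (2 ^ r / 4) ^ m := by
    intro m
    have hp : (ε * 2 ^ m) ^ 2 ≠ 0 := by positivity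
    have hp' : (ε * 2 ^ m) ^ 2 ≠ ∞ :=
      ENNReal.pow_ne_top (ENNReal.mul_ne_top hε' (ENNReal.pow_ne_top (by norm_num)))
    calc P {ω | ε * 2 ^ m ≤ 2 * dyadicMax G m 0 ω}
        ≤ P {ω | (ε * 2 ^ m) ^ 2 ≤ 4 * dyadicMax G m 0 ω ^ 2} := by
          refine measure_mono fun ω hω => ?_
          have : (ε * 2 ^ m) ^ 2 ≤ (2 * dyadicMax G m 0 ω) ^ 2 :=
            pow_le_pow_left' hω 2
          rw [mul_pow 2] at this
          norm_num at this
          exact this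
      _ ≤ (∫⁻ ω, 4 * dyadicMax G m 0 ω ^ 2 ∂P) / (ε * 2 ^ m) ^ 2 :=
          meas_ge_le_lintegral_div
            (((h.aemeasurable_dyadicMax m 0).pow_const 2).const_mul 4) hp hp'
      _ ≤ (4 * (10 * C * ((2 : ℝ≥0∞) ^ r) ^ m)) / (ε * 2 ^ m) ^ 2 := by
          rw [lintegral_const_mul'' _ ((h.aemeasurable_dyadicMax m 0).pow_const 2)]
          gcongr
          exact h.lintegral_dyadicMax_sq_le hr m 0
      _ = 40 * C / ε ^ 2 * (2 ^ r / 4) ^ m := by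
          have : (ε * 2 ^ m) ^ 2 = ε ^ 2 * 4 ^ m := by
            rw [mul_pow, ← pow_mul, mul_comm m, pow_mul]; norm_num
          rw [this, div_eq_mul_inv, div_eq_mul_inv, div_eq_mul_inv,
            ENNReal.mul_inv (Or.inr (by finiteness)) (Or.inr (by positivity)), mul_pow,
            ENNReal.inv_pow (a := 4)]
          ring
  calc P {ω | ∃ l : ℕ, ε * (l + 2 ^ m₀) < G 0 l ω}
      ≤ P (⋃ m, {ω | ε * 2 ^ (m₀ + m) ≤ 2 * dyadicMax G (m₀ + m) 0 ω}) := by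
        refine measure_mono fun ω ⟨l, hl⟩ => ?_
        exact Set.mem_iUnion.2 (h.exists_of_gt hl)
    _ ≤ ∑' m, P {ω | ε * 2 ^ (m₀ + m) ≤ 2 * dyadicMax G (m₀ + m) 0 ω} := measure_iUnion_le _
    _ ≤ ∑' m, 40 * C / ε ^ 2 * (2 ^ r / 4) ^ m₀ * (2 ^ r / 4) ^ m := by
        refine ENNReal.tsum_le_tsum fun m => (hstep _).trans_eq ?_
        rw [pow_add, mul_assoc]
    _ = _ := by
        rw [ENNReal.tsum_mul_left, ENNReal.tsum_geometric]
        ring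

/-- Here `r < 2` makes the ratio `2 ^ r / 4` of the geometric series less than 1. -/
lemma tendsto_hajekRenyi_bound (hr : r < 2) (hC : C ≠ ∞) {ε : ℝ≥0∞} (hε : ε ≠ 0) :
    Tendsto (fun m₀ : ℕ => 40 * C / ε ^ 2 * (1 - 2 ^ r / 4)⁻¹ * ((2 : ℝ≥0∞) ^ r / 4) ^ m₀)
      atTop (𝓝 0) := by
  have hq : (2 : ℝ≥0∞) ^ r / 4 < 1 := by
    rw [ENNReal.div_lt_iff (by norm_num) (by norm_num), one_mul]
    calc (2 : ℝ≥0∞) ^ r < 2 ^ (2 : ℝ) := ENNReal.rpow_lt_rpow_of_exponent_lt (by norm_num)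
          (by norm_num) hr
      _ = 4 := by rw [ENNReal.rpow_ofNat]; norm_num
  have h := ENNReal.Tendsto.const_mul (a := 40 * C / ε ^ 2 * (1 - 2 ^ r / 4)⁻¹)
    (ENNReal.tendsto_pow_atTop_nhds_zero_of_lt_one hq) (Or.inr ?_)
  · simpa using h
  · refine ENNReal.mul_ne_top (ENNReal.div_ne_top (by finiteness) (by positivity)) ?_
    exact ENNReal.inv_ne_top.2 (tsub_pos_of_lt hq).ne'

end Maximal

end ChangePoint

namespace ChangePoint

/-! ### Kullback-Leibler divergence and Hellinger distance -/

section Hellinger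

variable {α : Type*} [MeasurableSpace α] {μ : Measure α} {f g f' : α → ℝ}

lemma integrable_of_lintegral_ofReal_eq_one (hf : Measurable f) (hf0 : ∀ x, 0 ≤ f x)
    (hf1 : ∫⁻ x, ENNReal.ofReal (f x) ∂μ = 1) : Integrable f μ := by
  refine ⟨hf.aestronglyMeasurable, ?_⟩
  rw [hasFiniteIntegral_iff_ofReal (ae_of_all _ hf0), hf1]
  exact ENNReal.one_lt_top

lemma integral_eq_one_of_lintegral_ofReal_eq_one (hf : Measurable f) (hf0 : ∀ x, 0 ≤ f x)
    (hf1 : ∫⁻ x, ENNReal.ofReal (f x) ∂μ = 1) : ∫ x, f x ∂μ = 1 := by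
  rw [integral_eq_lintegral_of_nonneg_ae (ae_of_all _ hf0) hf.aestronglyMeasurable, hf1]
  rfl

lemma integrable_sqrt_sub_sqrt_sq (hf : Measurable f) (hf0 : ∀ x, 0 ≤ f x) (hfi : Integrable f μ)
    (hg : Measurable g) (hg0 : ∀ x, 0 ≤ g x) (hgi : Integrable g μ) :
    Integrable (fun x => (√(f x) - √(g x)) ^ 2) μ := by
  refine (hfi.add hgi).mono' ((hf.sqrt.sub hg.sqrt).pow_const 2).aestronglyMeasurable
    (ae_of_all _ fun x => ?_)
  rw [Real.norm_of_nonneg (sq_nonneg _), Pi.add_apply]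
  nlinarith [Real.sq_sqrt (hf0 x), Real.sq_sqrt (hg0 x), Real.sqrt_nonneg (f x),
    Real.sqrt_nonneg (g x), mul_nonneg (Real.sqrt_nonneg (f x)) (Real.sqrt_nonneg (g x))]

/-- The Kullback-Leibler divergence dominates the squared Hellinger distance. -/
theorem integral_sqrt_sub_sqrt_sq_le_integral_log_sub (hf : Measurable f) (hf0 : ∀ x, 0 ≤ f x)
    (hf1 : ∫⁻ x, ENNReal.ofReal (f x) ∂μ = 1) (hg : Measurable g) (hg0 : ∀ x, 0 ≤ g x)
    (hg1 : ∫⁻ x, ENNReal.ofReal (g x) ∂μ = 1)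
    (hpos : ∀ᵐ x ∂μ.withDensity fun x => ENNReal.ofReal (f x), 0 < g x)
    (hlf : Integrable (fun x => Real.log (f x)) (μ.withDensity fun x => ENNReal.ofReal (f x)))
    (hlg : Integrable (fun x => Real.log (g x)) (μ.withDensity fun x => ENNReal.ofReal (f x))) :
    ∫ x, (√(f x) - √(g x)) ^ 2 ∂μ
      ≤ ∫ x, Real.log (f x) ∂(μ.withDensity fun x => ENNReal.ofReal (f x))
        - ∫ x, Real.log (g x) ∂(μ.withDensity fun x => ENNReal.ofReal (f x)) := by
  have hfi := integrable_of_lintegral_ofReal_eq_one hf hf0 hf1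
  have hgi := integrable_of_lintegral_ofReal_eq_one hg hg0 hg1
  have hm : Measurable fun x => ENNReal.ofReal (f x) := hf.ennreal_ofReal
  have htop : ∀ᵐ x ∂μ, ENNReal.ofReal (f x) < ⊤ := ae_of_all _ fun _ => ENNReal.ofReal_lt_top
  rw [← integral_sub hlf hlg, integral_withDensity_eq_integral_toReal_smul hm htop]
  have hint := (integrable_withDensity_iff_integrable_smul' hm htop).1 (hlf.sub hlg)
  -- Adding `f - g` does not change the integral but makes the inequality pointwise: where `f = 0`
  -- both sides vanish, elsewhere it is `log y ≤ y - 1` at `y = √g / √f`.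
  have hzero : ∫ x, (f x - g x) ∂μ = 0 := by
    rw [integral_sub hfi hgi, integral_eq_one_of_lintegral_ofReal_eq_one hf hf0 hf1,
      integral_eq_one_of_lintegral_ofReal_eq_one hg hg0 hg1, sub_self]
  have hsq := integrable_sqrt_sub_sqrt_sq hf hf0 hfi hg hg0 hgi
  calc ∫ x, (√(f x) - √(g x)) ^ 2 ∂μ
      = ∫ x, ((√(f x) - √(g x)) ^ 2 + (f x - g x)) ∂μ := by
        have := integral_add hsq (hfi.sub hgi)
        simp only [Pi.sub_apply] at this
        rw [this, hzero, add_zero]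
    _ ≤ _ := by
        refine integral_mono_ae (hsq.add (hfi.sub hgi)) hint ?_
        filter_upwards [(ae_withDensity_iff hm).1 hpos] with x hx
        simp only [smul_eq_mul, ENNReal.toReal_ofReal (hf0 x)]
        rcases (hf0 x).eq_or_lt with h0 | h0
        · simp [← h0, Real.sq_sqrt (hg0 x)]
        · have hgx : 0 < g x := hx (by simpa using h0)
          have hsf := Real.sqrt_pos.2 h0
          have hsg := Real.sqrt_pos.2 hgx
          have hlog : Real.log (g x) - Real.log (f x) ≤ 2 * (√(g x) / √(f x) - 1) := by
            have := Real.log_le_sub_one_of_pos (div_pos hsg hsf)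
            rw [Real.log_div hsg.ne' hsf.ne', Real.log_sqrt hgx.le, Real.log_sqrt h0.le] at this
            linarith
          have hmul := mul_le_mul_of_nonneg_left hlog h0.le
          have e : f x * (2 * (√(g x) / √(f x) - 1)) = 2 * √(f x) * √(g x) - 2 * f x := by
            have : f x * (√(g x) / √(f x)) = √(f x) * √(g x) := by
              rw [mul_div_assoc', div_eq_iff hsf.ne']
              nlinarith [Real.sq_sqrt (hf0 x)]
            linear_combination 2 * this
          nlinarith [Real.sq_sqrt (hf0 x), Real.sq_sqrt (hg0 x)]

lemma integral_sqrt_sub_sqrt_sq_pos (hf : Measurable f) (hf0 : ∀ x, 0 ≤ f x)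
    (hfi : Integrable f μ) (hg : Measurable g) (hg0 : ∀ x, 0 ≤ g x) (hgi : Integrable g μ)
    (hne : μ {x | f x ≠ g x} ≠ 0) : 0 < ∫ x, (√(f x) - √(g x)) ^ 2 ∂μ := by
  rw [integral_pos_iff_support_of_nonneg (fun _ => sq_nonneg _)
    (integrable_sqrt_sub_sqrt_sq hf hf0 hfi hg hg0 hgi)]
  refine (pos_iff_ne_zero.2 hne).trans_le (measure_mono fun x hx => ?_)
  simp only [Set.mem_ofPred_eq, Function.mem_support] at hx ⊢
  refine pow_ne_zero 2 (sub_ne_zero.2 fun h => hx ?_)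
  exact (Real.sqrt_inj (hf0 x) (hg0 x)).1 h

/-- By the parallelogram identity the integrands differ by half of `(√f + √f' - 2 * √g) ^ 2`. -/
lemma half_integral_sqrt_sub_sqrt_sq_le (hf : Measurable f) (hf0 : ∀ x, 0 ≤ f x)
    (hfi : Integrable f μ) (hf' : Measurable f') (hf0' : ∀ x, 0 ≤ f' x) (hfi' : Integrable f' μ)
    (hg : Measurable g) (hg0 : ∀ x, 0 ≤ g x) (hgi : Integrable g μ) :
    (∫ x, (√(f x) - √(f' x)) ^ 2 ∂μ) / 2
      ≤ ∫ x, (√(f x) - √(g x)) ^ 2 ∂μ + ∫ x, (√(f' x) - √(g x)) ^ 2 ∂μ := by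
  rw [← integral_add (integrable_sqrt_sub_sqrt_sq hf hf0 hfi hg hg0 hgi)
    (integrable_sqrt_sub_sqrt_sq hf' hf0' hfi' hg hg0 hgi), ← integral_div]
  refine integral_mono ((integrable_sqrt_sub_sqrt_sq hf hf0 hfi hf' hf0' hfi').div_const 2)
    ((integrable_sqrt_sub_sqrt_sq hf hf0 hfi hg hg0 hgi).add
      (integrable_sqrt_sub_sqrt_sq hf' hf0' hfi' hg hg0 hgi)) fun x => ?_
  nlinarith [sq_nonneg (√(f x) + √(f' x) - 2 * √(g x))]

end Hellinger

/-! ### Separation of neighbouring segments -/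

section Separation

variable {k p d : ℕ} {dθ : Fin (k + 1) → ℕ} (M : Model k p d dθ)

/-- The expected log-likelihood contribution to segment `j` of an observation from segment `s`. -/
noncomputable def Model.meanLog (s j : Fin (k + 1)) (ψ : Vec d) (θ : Vec (dθ j)) : ℝ :=
  ∫ x, Real.log (M.f j ψ θ x) ∂M.law s

/-- The log-densities are integrable under the true distributions. -/
def Model.IntegrableLog : Prop :=
  ∀ s j, ∀ ψ ∈ M.Ψ, ∀ θ ∈ M.Θ j, Integrable (fun x => Real.log (M.f j ψ θ x)) (M.law s)

variable {M}

lemma Model.hellinger_le (hint : M.IntegrableLog) (hsmooth : M.SmoothLogLik) (s j : Fin (k + 1))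
    {ψ : Vec d} (hψ : ψ ∈ M.Ψ) {θ : Vec (dθ j)} (hθ : θ ∈ M.Θ j) :
    ∫ x, (√(M.f₀ s x) - √(M.f j ψ θ x)) ^ 2
      ≤ M.meanLog s s M.ψ₀ (M.θ₀ s) - M.meanLog s j ψ θ :=
  integral_sqrt_sub_sqrt_sq_le_integral_log_sub (M.measurable_f s _ M.ψ₀_mem _ (M.θ₀_mem s))
    (M.f_nonneg s _ M.ψ₀_mem _ (M.θ₀_mem s)) (M.lintegral_f s _ M.ψ₀_mem _ (M.θ₀_mem s))
    (M.measurable_f j ψ hψ θ hθ) (M.f_nonneg j ψ hψ θ hθ) (M.lintegral_f j ψ hψ θ hθ)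
    ((hsmooth s).mono fun _ hx => (hx j).1 ψ hψ θ hθ)
    (hint s s _ M.ψ₀_mem _ (M.θ₀_mem s)) (hint s j ψ hψ θ hθ)

lemma Model.meanLog_le (hint : M.IntegrableLog) (hsmooth : M.SmoothLogLik) (s j : Fin (k + 1))
    {ψ : Vec d} (hψ : ψ ∈ M.Ψ) {θ : Vec (dθ j)} (hθ : θ ∈ M.Θ j) :
    M.meanLog s j ψ θ ≤ M.meanLog s s M.ψ₀ (M.θ₀ s) := by
  have h := M.hellinger_le hint hsmooth s j hψ hθ
  have h0 : 0 ≤ ∫ x, (√(M.f₀ s x) - √(M.f j ψ θ x)) ^ 2 := integral_nonneg fun _ => sq_nonneg _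
  linarith

/-- No density is close to the true densities of two neighbouring segments. -/
lemma Model.exists_separation (hint : M.IntegrableLog) (hsmooth : M.SmoothLogLik)
    (hdiff : M.NeighboursDiffer) :
    ∃ κ : ℝ, 0 < κ ∧ ∀ (q : Fin k) (j : Fin (k + 1)), ∀ ψ ∈ M.Ψ, ∀ θ ∈ M.Θ j,
      κ ≤ (M.meanLog q.castSucc q.castSucc M.ψ₀ (M.θ₀ q.castSucc) - M.meanLog q.castSucc j ψ θ)
        + (M.meanLog q.succ q.succ M.ψ₀ (M.θ₀ q.succ) - M.meanLog q.succ j ψ θ) := by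
  have hfm : ∀ s, Measurable (M.f₀ s) := fun s => M.measurable_f s _ M.ψ₀_mem _ (M.θ₀_mem s)
  have hf0 : ∀ s x, 0 ≤ M.f₀ s x := fun s => M.f_nonneg s _ M.ψ₀_mem _ (M.θ₀_mem s)
  have hfi : ∀ s, Integrable (M.f₀ s) := fun s =>
    integrable_of_lintegral_ofReal_eq_one (hfm s) (hf0 s) (M.lintegral_f s _ M.ψ₀_mem _ (M.θ₀_mem s))
  set H : Fin k → ℝ := fun q => (∫ x, (√(M.f₀ q.castSucc x) - √(M.f₀ q.succ x)) ^ 2) / 2 with hH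
  have hpos : ∀ q, 0 < H q := fun q => half_pos <| integral_sqrt_sub_sqrt_sq_pos (hfm _) (hf0 _)
    (hfi _) (hfm _) (hf0 _) (hfi _) (by simpa only [ne_comm] using hdiff q)
  obtain ⟨κ, hκ, hκH⟩ : ∃ κ : ℝ, 0 < κ ∧ ∀ q, κ ≤ H q := by
    rcases isEmpty_or_nonempty (Fin k) with h | h
    · exact ⟨1, one_pos, fun q => h.elim q⟩
    · obtain ⟨q₀, hq₀⟩ := Finite.exists_min H
      exact ⟨H q₀, hpos q₀, hq₀⟩
  refine ⟨κ, hκ, fun q j ψ hψ θ hθ => (hκH q).trans ?_⟩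
  refine (half_integral_sqrt_sub_sqrt_sq_le (hfm _) (hf0 _) (hfi _) (hfm _) (hf0 _) (hfi _)
    (M.measurable_f j ψ hψ θ hθ) (M.f_nonneg j ψ hψ θ hθ) (integrable_of_lintegral_ofReal_eq_one
      (M.measurable_f j ψ hψ θ hθ) (M.f_nonneg j ψ hψ θ hθ) (M.lintegral_f j ψ hψ θ hθ))).trans ?_
  exact add_le_add (M.hellinger_le hint hsmooth _ j hψ hθ) (M.hellinger_le hint hsmooth _ j hψ hθ)

end Separation

end ChangePoint

namespace ChangePoint

/-! ### Suprema over parameters and bounds at anchor points -/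

section SupremumProcess

open scoped ENNReal

variable {Ω : Type*} [MeasurableSpace Ω] {P : Measure Ω} {C : ℝ≥0∞} {r : ℝ}
  {G : ℕ → ℕ → Ω → ℝ≥0∞}

lemma BlockBound.shift (h : BlockBound P C r G) (a : ℕ) :
    BlockBound P C r (fun s t => G (a + s) (a + t)) where
  aemeasurable s t := h.aemeasurable _ _
  self s := h.self _
  subadd s t u ω hst htu := h.subadd _ _ _ ω (by omega) (by omega)
  moment s l := by simpa only [add_assoc] using h.moment (a + s) l

/-- Reversal turns blocks ending at `a` into blocks starting at 0. Truncated subtraction can only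
shorten them, which is harmless for `0 ≤ r`. -/
lemma BlockBound.reverse (h : BlockBound P C r G) (hr : 0 ≤ r) (a : ℕ) :
    BlockBound P C r (fun s t => G (a - t) (a - s)) where
  aemeasurable s t := h.aemeasurable _ _
  self s := h.self _
  subadd s t u ω hst htu := by
    rw [add_comm]
    exact h.subadd _ _ _ ω (by omega) (by omega)
  moment s l := by
    have := h.moment (a - (s + l)) ((a - s) - (a - (s + l)))
    rw [show a - (s + l) + ((a - s) - (a - (s + l))) = a - s by omega] at this
    refine this.trans ?_
    gcongr
    omega

/-- Up to small probability, block sums starting or ending at `a` are at most `ε` times the length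
of the block, apart from a constant. -/
lemma BlockBound.measure_anchor_le (h : BlockBound P C r G) (hr : 3 / 2 ≤ r) {ε : ℝ≥0∞}
    (hε : ε ≠ 0) (hε' : ε ≠ ∞) (m₀ a : ℕ) :
    P {ω | ∃ l : ℕ, ε * (l + 2 ^ m₀) < G a (a + l) ω ∨ ε * (l + 2 ^ m₀) < G (a - l) a ω}
      ≤ 2 * (40 * C / ε ^ 2 * (1 - 2 ^ r / 4)⁻¹ * (2 ^ r / 4) ^ m₀) := by
  calc _ ≤ P ({ω | ∃ l : ℕ, ε * (l + 2 ^ m₀) < G a (a + l) ω}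
          ∪ {ω | ∃ l : ℕ, ε * (l + 2 ^ m₀) < G (a - l) a ω}) := by
        refine measure_mono fun ω ⟨l, hl⟩ => ?_
        exact hl.imp (fun h => ⟨l, h⟩) (fun h => ⟨l, h⟩)
    _ ≤ _ := by
        refine (measure_union_le _ _).trans ?_
        rw [two_mul]
        exact add_le_add ((h.shift a).measure_exists_gt_le hr hε hε' m₀)
          ((h.reverse (by linarith) a).measure_exists_gt_le hr hε hε' m₀)

variable [IsProbabilityMeasure P] {E : Type*} [PseudoMetricSpace E]
  [TopologicalSpace.SeparableSpace E] {K : Set E} {ℓ : E → ℕ → Ω → ℝ} {n : ℕ}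

/-- Only the centred variables are dominated. At one point `ω₀` where `u l ω₀` converges and the
domination holds, the means stay within `Z ω₀` of a bounded sequence; so they are bounded and
dominated convergence applies. -/
lemma tendsto_integral_of_abs_sub_integral_le {u : ℕ → Ω → ℝ} {v : Ω → ℝ} {Z : Ω → ℝ≥0∞}
    (hZ : AEMeasurable Z P) (hZint : ∫⁻ ω, Z ω ∂P ≠ ∞) (hu : ∀ l, Integrable (u l) P)
    (hlim : ∀ᵐ ω ∂P, Tendsto (fun l => u l ω) atTop (𝓝 (v ω)))
    (hle : ∀ᵐ ω ∂P, ∀ l, ‖u l ω - ∫ ω', u l ω' ∂P‖ₑ ≤ Z ω) :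
    Tendsto (fun l => ∫ ω, u l ω ∂P) atTop (𝓝 (∫ ω, v ω ∂P)) := by
  have hfin := ae_lt_top' hZ hZint
  have hle' : ∀ᵐ ω ∂P, ∀ l, |u l ω - ∫ ω', u l ω' ∂P| ≤ (Z ω).toReal := by
    filter_upwards [hle, hfin] with ω h1 h2 l
    have := ENNReal.toReal_mono h2.ne (h1 l)
    simpa using this
  obtain ⟨ω₀, h1, h2⟩ := (hlim.and hle').exists
  obtain ⟨b, hb⟩ := h1.abs.bddAbove_range
  have hmean : ∀ l, |∫ ω', u l ω' ∂P| ≤ b + (Z ω₀).toReal := by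
    intro l
    have h3 : |u l ω₀| ≤ b := hb ⟨l, rfl⟩
    have h4 := h2 l
    rw [abs_le] at *
    constructor <;> linarith
  refine tendsto_integral_of_dominated_convergence (fun ω => (Z ω).toReal + (b + (Z ω₀).toReal))
    (fun l => (hu l).aestronglyMeasurable)
    ((integrable_toReal_of_lintegral_ne_top hZ hZint).add (integrable_const _))
    (fun l => ?_) hlim
  filter_upwards [hle'] with ω h
  have h3 := h l
  have h4 := hmean l
  rw [Real.norm_eq_abs]
  rw [abs_le] at *
  constructor <;> linarith

/-- Uniformly in the parameter `φ ∈ K`, centred block sums of random functions continuous in `φ` are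
bounded by a measurable subadditive family with the same second moments. -/
theorem exists_blockBound (hint : ∀ i ∈ Finset.Icc 1 n, ∀ φ ∈ K, Integrable (ℓ φ i) P)
    (hcont : ∀ i ∈ Finset.Icc 1 n, ∀ᵐ ω ∂P, ContinuousOn (fun φ => ℓ φ i ω) K) {C : ℝ} (hC : 0 ≤ C)
    (hmom : ∀ s t : ℕ, s < t → t ≤ n →
      ∫⁻ ω, (⨆ φ ∈ K, ENNReal.ofReal
        ((∑ i ∈ Finset.Ioc s t, (ℓ φ i ω - ∫ ω', ℓ φ i ω' ∂P)) ^ 2)) ∂P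
        ≤ ENNReal.ofReal (C * ((t : ℝ) - s) ^ r)) (hr : 0 < r) :
    ∃ G : ℕ → ℕ → Ω → ℝ≥0∞, BlockBound P (ENNReal.ofReal C) r G ∧
      ∀ᵐ ω ∂P, ∀ s t, s ≤ t → t ≤ n → ∀ φ ∈ K,
        ‖∑ i ∈ Finset.Ioc s t, (ℓ φ i ω - ∫ ω', ℓ φ i ω' ∂P)‖ₑ ≤ G s t ω := by
  -- The supremum over a countable dense `D` is measurable and inherits the moment bound by
  -- monotonicity; continuity in `φ` recovers all of `K`.
  obtain ⟨D, hDK, hD, hKD⟩ :=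
    (TopologicalSpace.IsSeparable.of_separableSpace K).exists_countable_dense_subset
  set ξ : E → ℕ → Ω → ℝ := fun φ i ω => ℓ φ i ω - ∫ ω', ℓ φ i ω' ∂P with hξ
  set S : ℕ → ℕ → Ω → ℝ≥0∞ := fun s t ω => ⨆ φ ∈ D, ‖∑ i ∈ Finset.Ioc s t, ξ φ i ω‖ₑ with hS
  have hξm : ∀ i ∈ Finset.Icc 1 n, ∀ φ ∈ K, AEMeasurable (ξ φ i) P := fun i hi φ hφ =>
    ((hint i hi φ hφ).sub (integrable_const _)).aemeasurable
  have hSm : ∀ s t, t ≤ n → AEMeasurable (S s t) P := by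
    intro s t ht
    refine AEMeasurable.biSup D hD fun φ hφ => ?_
    refine (Finset.aemeasurable_fun_sum _ fun i hi => hξm i ?_ φ (hDK hφ)).enorm
    simp only [Finset.mem_Ioc, Finset.mem_Icc] at hi ⊢
    omega
  have hSmom : ∀ s l, s + l ≤ n →
      ∫⁻ ω, S s (s + l) ω ^ 2 ∂P ≤ ENNReal.ofReal C * (l : ℝ≥0∞) ^ r := by
    intro s l hl
    rcases Nat.eq_zero_or_pos l with rfl | hpos
    · simp [hS, ENNReal.zero_rpow_of_pos hr]
    · refine (lintegral_mono fun ω => ?_).trans ((hmom s (s + l) (by omega) hl).trans_eq ?_)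
      · have hsq : ∀ y : ℝ, ENNReal.ofReal (y ^ 2) = ‖y‖ₑ ^ 2 := by
          intro y
          rw [← sq_abs, ENNReal.ofReal_pow (abs_nonneg y), ← Real.enorm_eq_ofReal_abs]
        simp only [hsq]
        rw [← ENNReal.rpow_natCast, ← ENNReal.le_rpow_inv_iff (by norm_num)]
        refine iSup₂_le fun φ hφ => ?_
        rw [ENNReal.le_rpow_inv_iff (by norm_num), ENNReal.rpow_natCast]
        exact le_iSup₂ (f := fun φ (_ : φ ∈ K) => ‖∑ i ∈ Finset.Ioc s (s + l), ξ φ i ω‖ₑ ^ 2)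
          φ (hDK hφ)
      · rw [ENNReal.ofReal_mul hC, Nat.cast_add, add_sub_cancel_left,
          ← ENNReal.ofReal_rpow_of_pos (by exact_mod_cast hpos), ENNReal.ofReal_natCast]
  have hdom : ∀ᵐ ω ∂P, ∀ s t, t ≤ n → ∀ φ ∈ K, ‖∑ i ∈ Finset.Ioc s t, ξ φ i ω‖ₑ ≤ S s t ω := by
    -- The centring must be continuous as well. The supremum for the single observation `i`, whose
    -- second moment is finite by the bound for length 1, serves as dominating function.
    have hmean : ∀ i ∈ Finset.Icc 1 n, ∀ φ ∈ K, ∀ u : ℕ → E, (∀ l, u l ∈ D) →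
        Tendsto u atTop (𝓝 φ) →
        Tendsto (fun l => ∫ ω', ℓ (u l) i ω' ∂P) atTop (𝓝 (∫ ω', ℓ φ i ω' ∂P)) := by
      intro i hi φ hφ u hu hlim
      obtain ⟨hi1, hi2⟩ := Finset.mem_Icc.1 hi
      have hm := hSm (i - 1) i hi2
      refine tendsto_integral_of_abs_sub_integral_le hm ?_ (fun l => hint i hi _ (hDK (hu l))) ?_ ?_
      · have h2 := hSmom (i - 1) 1 (by omega)
        rw [Nat.sub_add_cancel hi1] at h2
        have hle : ∫⁻ ω, S (i - 1) i ω ∂P ≤ ∫⁻ ω, (1 + S (i - 1) i ω ^ 2) ∂P := by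
          refine lintegral_mono fun ω => ?_
          rcases le_total (S (i - 1) i ω) 1 with h | h
          · exact h.trans le_self_add
          · exact (le_self_pow₀ h two_ne_zero).trans le_add_self
        refine ne_top_of_le_ne_top ?_ hle
        rw [lintegral_add_left measurable_const]
        refine ENNReal.add_ne_top.2 ⟨by simp, ne_top_of_le_ne_top ?_ h2⟩
        simp
      · filter_upwards [hcont i hi] with ω hω
        exact (hω φ hφ).tendsto.comp (tendsto_nhdsWithin_iff.2
          ⟨hlim, Eventually.of_forall fun l => hDK (hu l)⟩)
      · refine ae_of_all _ fun ω l => ?_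
        have hone : Finset.Ioc (i - 1) i = {i} := by
          ext x
          simp only [Finset.mem_Ioc, Finset.mem_singleton]
          omega
        have := le_iSup₂ (f := fun φ (_ : φ ∈ D) => ‖∑ i ∈ Finset.Ioc (i - 1) i, ξ φ i ω‖ₑ)
          (u l) (hu l)
        simp only [hone, Finset.sum_singleton] at this
        simpa only [hS, hone, Finset.sum_singleton] using this
    have hcont' : ∀ᵐ ω ∂P, ∀ i ∈ Finset.Icc 1 n, ContinuousOn (fun φ => ℓ φ i ω) K := by
      rw [Filter.eventually_all_finset]
      exact hcont
    filter_upwards [hcont'] with ω hω s t ht φ hφ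
    obtain ⟨u, hu, hlim⟩ := mem_closure_iff_seq_limit.1 (hKD hφ)
    have hT : Tendsto (fun l => ‖∑ i ∈ Finset.Ioc s t, ξ (u l) i ω‖ₑ) atTop
        (𝓝 ‖∑ i ∈ Finset.Ioc s t, ξ φ i ω‖ₑ) := by
      refine (tendsto_finsetSum _ fun i hi => ?_).enorm
      have hi' : i ∈ Finset.Icc 1 n := by
        simp only [Finset.mem_Ioc, Finset.mem_Icc] at hi ⊢
        omega
      refine Tendsto.sub ?_ (hmean i hi' φ hφ u hu hlim)
      exact (hω i hi' φ hφ).tendsto.comp (tendsto_nhdsWithin_iff.2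
          ⟨hlim, Eventually.of_forall fun l => hDK (hu l)⟩)
    refine le_of_tendsto hT (Eventually.of_forall fun l => ?_)
    exact le_iSup₂ (f := fun φ (_ : φ ∈ D) => ‖∑ i ∈ Finset.Ioc s t, ξ φ i ω‖ₑ) (u l) (hu l)
  -- Truncation at `n` extends the family to all blocks and only shortens them.
  refine ⟨fun s t => S (min s n) (min t n), ⟨fun s t => hSm _ _ (min_le_right _ _), ?_, ?_, ?_⟩, ?_⟩
  · intro s ω
    simp [hS]
  · intro s t u ω hst htu
    refine iSup₂_le fun φ hφ => ?_
    have hdisj : Disjoint (Finset.Ioc (min s n) (min t n)) (Finset.Ioc (min t n) (min u n)) := by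
      rw [Finset.disjoint_left]
      intro i hi hi'
      simp only [Finset.mem_Ioc] at hi hi'
      omega
    rw [← Finset.Ioc_union_Ioc_eq_Ioc (b := min t n) (by omega) (by omega),
      Finset.sum_union hdisj]
    refine (enorm_add_le _ _).trans (add_le_add ?_ ?_)
    · exact le_iSup₂ (f := fun φ (_ : φ ∈ D) =>
        ‖∑ i ∈ Finset.Ioc (min s n) (min t n), ξ φ i ω‖ₑ) φ hφ
    · exact le_iSup₂ (f := fun φ (_ : φ ∈ D) =>
        ‖∑ i ∈ Finset.Ioc (min t n) (min u n), ξ φ i ω‖ₑ) φ hφ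
  · intro s l
    have := hSmom (min s n) (min (s + l) n - min s n) (by omega)
    rw [show min s n + (min (s + l) n - min s n) = min (s + l) n by omega] at this
    refine this.trans ?_
    gcongr
    omega
  · filter_upwards [hdom] with ω hω s t hst ht φ hφ
    simpa only [min_eq_left ht, min_eq_left (hst.trans ht)] using hω s t ht φ hφ

end SupremumProcess

end ChangePoint

namespace ChangePoint

/-! ### Tightness of the estimated change points -/

section Rate

open scoped ENNReal

variable {k p d : ℕ} {dθ : Fin (k + 1) → ℕ} {M : Model k p d dθ}
  {Ω : Type*} [MeasurableSpace Ω] {P : Measure Ω} {n : ℕ} {c₀ : Fin k → ℕ} {X : ℕ → Ω → Vec p}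

lemma Model.IsSample.ae_of_ae_law (hX : M.IsSample P n c₀ X) {s : Fin (k + 1)} {i : ℕ}
    (hi : i ∈ segment n c₀ s) {Q : Vec p → Prop} (hQ : ∀ᵐ x ∂M.law s, Q x) :
    ∀ᵐ ω ∂P, Q (X i ω) := by
  rw [← (hX.hasLaw s i hi).map_eq] at hQ
  exact ae_of_ae_map (hX.hasLaw s i hi).aemeasurable hQ

lemma Model.measurable_log (M : Model k p d dθ) (j : Fin (k + 1)) {ψ : Vec d} (hψ : ψ ∈ M.Ψ)
    {θ : Vec (dθ j)} (hθ : θ ∈ M.Θ j) : Measurable fun x => Real.log (M.f j ψ θ x) :=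
  Real.measurable_log.comp (M.measurable_f j ψ hψ θ hθ)

lemma Model.IsSample.integral_log (hX : M.IsSample P n c₀ X) {s : Fin (k + 1)} {i : ℕ}
    (hi : i ∈ segment n c₀ s) (j : Fin (k + 1)) {ψ : Vec d} (hψ : ψ ∈ M.Ψ) {θ : Vec (dθ j)}
    (hθ : θ ∈ M.Θ j) : ∫ ω, Real.log (M.f j ψ θ (X i ω)) ∂P = M.meanLog s j ψ θ :=
  (hX.hasLaw s i hi).integral_comp (M.measurable_log j hψ hθ).aestronglyMeasurable

lemma Model.IsSample.integrableLog (hX : M.IsSample P n c₀ X)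
    (hint : ∀ i ∈ Finset.Icc 1 n, ∀ j, ∀ ψ ∈ M.Ψ, ∀ θ ∈ M.Θ j,
      Integrable (fun ω => Real.log (M.f j ψ θ (X i ω))) P) : M.IntegrableLog := by
  intro s j ψ hψ θ hθ
  obtain ⟨i, hi⟩ := segment_nonempty hX.isConfiguration s
  have hi' : i ∈ Finset.Icc 1 n := by
    have := segment_subset hX.isConfiguration s hi
    simp only [Finset.mem_Ioc, Finset.mem_Icc] at this ⊢
    omega
  have hl := hX.hasLaw s i hi
  rw [← hl.map_eq, integrable_map_measure (M.measurable_log j hψ hθ).aestronglyMeasurable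
    hl.aemeasurable]
  exact hint i hi' j ψ hψ θ hθ

lemma abs_le_of_enorm_le_ofReal_mul {x ε : ℝ} (hε : 0 ≤ ε) {l m₀ : ℕ}
    (h : ‖x‖ₑ ≤ ENNReal.ofReal ε * (l + 2 ^ m₀)) : |x| ≤ ε * (l + 2 ^ m₀) := by
  have e : ENNReal.ofReal ε * (l + 2 ^ m₀) = ENNReal.ofReal (ε * (l + 2 ^ m₀)) := by
    rw [ENNReal.ofReal_mul hε, ENNReal.ofReal_add (by positivity) (by positivity),
      ENNReal.ofReal_pow (by norm_num)]
    simp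
  rw [e, Real.enorm_eq_ofReal_abs, ENNReal.ofReal_le_ofReal_iff (by positivity)] at h
  exact h

/-- Tail bound for the maximum likelihood estimators of the change points in a single sample. -/
theorem Model.IsSample.measure_lt_abs_sub_le [IsProbabilityMeasure P] (hX : M.IsSample P n c₀ X)
    (hsmooth : M.SmoothLogLik) (hintM : M.IntegrableLog)
    (hint : ∀ i ∈ Finset.Icc 1 n, ∀ j, ∀ ψ ∈ M.Ψ, ∀ θ ∈ M.Θ j,
      Integrable (fun ω => Real.log (M.f j ψ θ (X i ω))) P)
    {C r : ℝ} (hC : 0 ≤ C) (hr : 3 / 2 ≤ r)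
    (hmom : ∀ j, ∀ s t : ℕ, s < t → t ≤ n →
      ∫⁻ ω, (⨆ ψ ∈ M.Ψ, ⨆ θ ∈ M.Θ j, ENNReal.ofReal
          ((∑ i ∈ Finset.Ioc s t, (Real.log (M.f j ψ θ (X i ω))
            - ∫ ω', Real.log (M.f j ψ θ (X i ω')) ∂P)) ^ 2)) ∂P
        ≤ ENNReal.ofReal (C * ((t : ℝ) - s) ^ r))
    {κ : ℝ} (hκ : 0 < κ)
    (hsep : ∀ (q : Fin k) (j : Fin (k + 1)), ∀ ψ ∈ M.Ψ, ∀ θ ∈ M.Θ j,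
      κ ≤ (M.meanLog q.castSucc q.castSucc M.ψ₀ (M.θ₀ q.castSucc) - M.meanLog q.castSucc j ψ θ)
        + (M.meanLog q.succ q.succ M.ψ₀ (M.θ₀ q.succ) - M.meanLog q.succ j ψ θ))
    {R : ℕ} (hR : 0 < R)
    (hgap : ∀ j : Fin (k + 1), boundary n c₀ j.castSucc + 3 * R ≤ boundary n c₀ j.succ)
    {ε : ℝ} (hε : 0 < ε) (hεκ : ε * (8 * (k + 1)) ≤ κ) {m₀ : ℕ}
    (hU : 4 * (k + 1) * (ε * (n + 2 ^ m₀)) ≤ κ / 8 * R)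
    {nhat : Ω → Fin k → ℕ} {ψhat : Ω → Vec d} {θhat : Ω → (j : Fin (k + 1)) → Vec (dθ j)}
    (hML : ∀ᵐ ω ∂P, M.IsMLE n (fun i => X i ω) (nhat ω) (ψhat ω) (θhat ω)) :
    P {ω | ∃ q, (2 : ℝ) ^ m₀ < |(nhat ω q : ℝ) - c₀ q|}
      ≤ (k + 1) * ((k + 2) * (2 * (40 * ENNReal.ofReal C / ENNReal.ofReal ε ^ 2
          * (1 - 2 ^ r / 4)⁻¹ * (2 ^ r / 4) ^ m₀))) := by
  have hmemSeg : ∀ i ∈ Finset.Icc 1 n, ∃ s, i ∈ segment n c₀ s := fun i hi =>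
    exists_mem_segment c₀ (by simp only [Finset.mem_Ioc, Finset.mem_Icc] at hi ⊢; omega)
  have hG : ∀ j : Fin (k + 1), ∃ G : ℕ → ℕ → Ω → ℝ≥0∞, BlockBound P (ENNReal.ofReal C) r G ∧
      ∀ᵐ ω ∂P, ∀ s t, s ≤ t → t ≤ n → ∀ φ ∈ M.Ψ ×ˢ M.Θ j,
        ‖∑ i ∈ Finset.Ioc s t, (Real.log (M.f j φ.1 φ.2 (X i ω))
          - ∫ ω', Real.log (M.f j φ.1 φ.2 (X i ω')) ∂P)‖ₑ ≤ G s t ω := by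
    intro j
    refine exists_blockBound (K := M.Ψ ×ˢ M.Θ j)
      (ℓ := fun φ i ω => Real.log (M.f j φ.1 φ.2 (X i ω)))
      (fun i hi φ hφ => hint i hi j φ.1 hφ.1 φ.2 hφ.2) (fun i hi => ?_) hC
      (fun s t hst ht => ?_) (by linarith)
    · obtain ⟨s, hs⟩ := hmemSeg i hi
      exact hX.ae_of_ae_law hs ((hsmooth s).mono fun x hx => (hx j).2.continuousOn)
    · simp only [biSup_prod]
      exact hmom j s t hst ht
  choose G hGB hGle using hG
  -- The anchors `c₀ q` give the local bounds with `δ = 2 ^ m₀`; the anchor 0 gives the global bound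
  -- `U = ε * (n + 2 ^ m₀)`.
  set B : Fin (k + 1) → Fin (k + 2) → Set Ω := fun j J =>
    {ω | ∃ l : ℕ, ENNReal.ofReal ε * (l + 2 ^ m₀) < G j (boundary n c₀ J) (boundary n c₀ J + l) ω ∨
      ENNReal.ofReal ε * (l + 2 ^ m₀) < G j (boundary n c₀ J - l) (boundary n c₀ J) ω} with hB
  have hsub : {ω | ∃ q, (2 : ℝ) ^ m₀ < |(nhat ω q : ℝ) - c₀ q|} ≤ᵐ[P] ⋃ j, ⋃ J, B j J := by
    filter_upwards [hML, eventually_all.2 hGle] with ω hω hle ⟨q, hq⟩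
    change ω ∈ ⋃ j, ⋃ J, B j J
    by_contra hgood
    simp only [Set.mem_iUnion, not_exists] at hgood
    refine hq.not_ge ?_
    have hc₀ := hX.isConfiguration
    have hfwd : ∀ j J l, boundary n c₀ J + l ≤ n → ∀ ψ ∈ M.Ψ, ∀ θ ∈ M.Θ j,
        |∑ i ∈ Finset.Ioc (boundary n c₀ J) (boundary n c₀ J + l),
          (Real.log (M.f j ψ θ (X i ω)) - ∫ ω', Real.log (M.f j ψ θ (X i ω')) ∂P)|
          ≤ ε * (l + 2 ^ m₀) := by
      intro j J l hl ψ hψ θ hθ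
      refine abs_le_of_enorm_le_ofReal_mul hε.le
        ((hle j _ _ (Nat.le_add_right _ _) hl (ψ, θ) ⟨hψ, hθ⟩).trans ?_)
      by_contra! hlt
      exact hgood j J ⟨l, Or.inl hlt⟩
    have hbwd : ∀ j J l, ∀ ψ ∈ M.Ψ, ∀ θ ∈ M.Θ j,
        |∑ i ∈ Finset.Ioc (boundary n c₀ J - l) (boundary n c₀ J),
          (Real.log (M.f j ψ θ (X i ω)) - ∫ ω', Real.log (M.f j ψ θ (X i ω')) ∂P)|
          ≤ ε * (l + 2 ^ m₀) := by
      intro j J l ψ hψ θ hθ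
      refine abs_le_of_enorm_le_ofReal_mul hε.le
        ((hle j _ _ (Nat.sub_le _ _) (hc₀.boundary_le J) (ψ, θ) ⟨hψ, hθ⟩).trans ?_)
      by_contra! hlt
      exact hgood j J ⟨l, Or.inr hlt⟩
    have hzero : ∀ j, ∀ t ≤ n, ∀ ψ ∈ M.Ψ, ∀ θ ∈ M.Θ j,
        |∑ i ∈ Finset.Ioc 0 t,
          (Real.log (M.f j ψ θ (X i ω)) - ∫ ω', Real.log (M.f j ψ θ (X i ω')) ∂P)|
          ≤ ε * (n + 2 ^ m₀) := by
      intro j t ht ψ hψ θ hθ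
      have h := hfwd j 0 t (by simpa using ht) ψ hψ θ hθ
      rw [boundary_zero, zero_add] at h
      refine h.trans ?_
      gcongr
    refine abs_sub_le_of_fluctuations hω.isConfiguration hc₀ hR hgap
      (a := fun j i => Real.log (M.f j (ψhat ω) (θhat ω j) (X i ω)))
      (b := fun j i => Real.log (M.f j M.ψ₀ (M.θ₀ j) (X i ω)))
      (Ea := fun j i => ∫ ω', Real.log (M.f j (ψhat ω) (θhat ω j) (X i ω')) ∂P)
      (Eb := fun j i => ∫ ω', Real.log (M.f j M.ψ₀ (M.θ₀ j) (X i ω')) ∂P)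
      (A := fun s j => M.meanLog s j (ψhat ω) (θhat ω j))
      (B := fun s => M.meanLog s s M.ψ₀ (M.θ₀ s))
      (fun j s i hi => hX.integral_log hi j hω.ψ_mem (hω.θ_mem j))
      (fun s i hi => hX.integral_log hi s M.ψ₀_mem (M.θ₀_mem s))
      hκ (by positivity) hεκ hU
      (fun s j => M.meanLog_le hintM hsmooth s j hω.ψ_mem (hω.θ_mem j))
      (fun q j => hsep q j _ hω.ψ_mem _ (hω.θ_mem j))
      (fun j t ht => hzero j t ht _ hω.ψ_mem _ (hω.θ_mem j))
      (fun j t ht => hzero j t ht _ M.ψ₀_mem _ (M.θ₀_mem j)) ?_ ?_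
      (hω.logLik_le c₀ M.ψ₀ M.θ₀ hc₀ M.ψ₀_mem M.θ₀_mem)
      (hω.logLik_le c₀ _ _ hc₀ hω.ψ_mem hω.θ_mem) q
    · intro j q t hqt ht
      have h := hfwd j q.castSucc.succ (t - c₀ q) (by rw [boundary_castSucc_succ]; omega)
        _ hω.ψ_mem _ (hω.θ_mem j)
      rwa [boundary_castSucc_succ, Nat.add_sub_cancel' hqt, Nat.cast_sub hqt] at h
    · intro j q t ht
      have h := hbwd j q.castSucc.succ (c₀ q - t) _ hω.ψ_mem _ (hω.θ_mem j)
      rwa [boundary_castSucc_succ, Nat.sub_sub_self ht, Nat.cast_sub ht] at h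
  calc P {ω | ∃ q, (2 : ℝ) ^ m₀ < |(nhat ω q : ℝ) - c₀ q|}
      ≤ P (⋃ j, ⋃ J, B j J) := measure_mono_ae hsub
    _ ≤ ∑ j, P (⋃ J, B j J) := measure_iUnion_fintype_le _ _
    _ ≤ ∑ j, ∑ J, P (B j J) := Finset.sum_le_sum fun j _ => measure_iUnion_fintype_le _ _
    _ ≤ ∑ _j : Fin (k + 1), ∑ _J : Fin (k + 2), 2 * (40 * ENNReal.ofReal C / ENNReal.ofReal ε ^ 2
          * (1 - 2 ^ r / 4)⁻¹ * (2 ^ r / 4) ^ m₀) :=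
        Finset.sum_le_sum fun j _ => Finset.sum_le_sum fun J _ =>
          (hGB j).measure_anchor_le hr (by simpa using hε) ENNReal.ofReal_ne_top m₀ _
    _ = _ := by
        simp only [Finset.sum_const, Finset.card_univ, Fintype.card_fin, nsmul_eq_mul]
        push_cast
        ring

/-- If the change points are asymptotically at fixed fractions of the sample size, the lengths of
the segments are of the order of the sample size. -/
lemma exists_forall_segment_length {lam₀ : Fin k → ℝ} (hlam_mono : StrictMono lam₀)
    (hlam : ∀ j, 0 < lam₀ j ∧ lam₀ j < 1) {N : ℕ → ℕ} (hN : Tendsto N atTop atTop)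
    {n₀ : ℕ → Fin k → ℕ} (hn₀ : ∀ m j, |(n₀ m j : ℝ) - N m * lam₀ j| < 1) :
    ∃ ρ : ℝ, 0 < ρ ∧ ∀ᶠ m in atTop, ∃ R : ℕ, 0 < R ∧ ρ * N m ≤ R ∧
      ∀ j : Fin (k + 1), boundary (N m) (n₀ m) j.castSucc + 3 * R ≤ boundary (N m) (n₀ m) j.succ := by
  set L : Fin (k + 2) → ℝ :=
    Fin.cons (α := fun _ => ℝ) 0 (Fin.snoc (α := fun _ => ℝ) lam₀ 1) with hL
  have hL0 : L 0 = 0 := rfl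
  have hL1 : L (Fin.last (k + 1)) = 1 := by
    rw [hL, ← Fin.succ_last, Fin.cons_succ, Fin.snoc_last]
  have hLc : ∀ q : Fin k, L q.castSucc.succ = lam₀ q := by
    intro q
    rw [hL, Fin.cons_succ, Fin.snoc_castSucc]
  have hLs : ∀ q : Fin k, L q.succ.castSucc = lam₀ q := by
    intro q
    rw [← Fin.succ_castSucc, hLc]
  have hmono : ∀ j : Fin (k + 1), L j.castSucc < L j.succ := by
    intro j
    refine Fin.cases ?_ (fun q => ?_) j
    · rw [Fin.castSucc_zero, hL0]
      refine Fin.lastCases ?_ (fun q => ?_) (0 : Fin (k + 1))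
      · rw [Fin.succ_last, hL1]; exact one_pos
      · rw [hLc]; exact (hlam q).1
    · rw [hLs]
      rcases Fin.eq_castSucc_or_eq_last q.succ with ⟨q', hq'⟩ | hq'
      · rw [hq', hLc]
        apply hlam_mono
        rw [← Fin.castSucc_lt_castSucc_iff, ← hq']
        exact q.castSucc_lt_succ
      · rw [hq', Fin.succ_last, hL1]
        exact (hlam q).2
  have hb : ∀ m J, |(boundary (N m) (n₀ m) J : ℝ) - N m * L J| ≤ 1 := by
    intro m J
    refine Fin.cases ?_ (fun J => ?_) J
    · simp [hL0]
    · refine Fin.lastCases ?_ (fun q => ?_) J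
      · rw [Fin.succ_last, boundary_last, hL1]; simp
      · rw [boundary_castSucc_succ, hLc]; exact (hn₀ m q).le
  obtain ⟨j₀, hj₀⟩ := Finite.exists_min fun j : Fin (k + 1) => L j.succ - L j.castSucc
  set Δ := L j₀.succ - L j₀.castSucc with hΔ
  have hΔpos : 0 < Δ := sub_pos.2 (hmono j₀)
  -- Up to rounding each segment has length at least `Δ * N m - 2`, and three times the ceiling of
  -- `Δ / 6 * N m` is below `Δ * N m / 2 + 3`; so `Δ * N m ≥ 10` suffices.
  refine ⟨Δ / 6, by positivity, ?_⟩
  have hlarge : ∀ᶠ m in atTop, 10 / Δ ≤ N m :=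
    (tendsto_natCast_atTop_atTop.comp hN).eventually_ge_atTop _
  filter_upwards [hlarge] with m hm
  rw [div_le_iff₀ hΔpos] at hm
  have hpos : 0 < Δ / 6 * N m := by nlinarith
  refine ⟨⌈Δ / 6 * N m⌉₊, Nat.ceil_pos.2 hpos, Nat.le_ceil _, fun j => ?_⟩
  have hceil := Nat.ceil_lt_add_one hpos.le
  have h1 := (abs_le.1 (hb m j.castSucc)).2
  have h2 := (abs_le.1 (hb m j.succ)).1
  have h3 := mul_le_mul_of_nonneg_left (hj₀ j) (Nat.cast_nonneg (α := ℝ) (N m))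
  have h4 : (boundary (N m) (n₀ m) j.castSucc + 3 * ⌈Δ / 6 * N m⌉₊ : ℝ)
      ≤ boundary (N m) (n₀ m) j.succ := by
    nlinarith
  exact_mod_cast h4

end Rate

/-- Uniform tightness of the errors of the estimated change points. -/
theorem exists_forall_measure_lt_abs_sub_le {k p d : ℕ} {dθ : Fin (k + 1) → ℕ}
    (M : Model k p d dθ) {lam₀ : Fin k → ℝ} (hlam_mono : StrictMono lam₀)
    (hlam : ∀ j, 0 < lam₀ j ∧ lam₀ j < 1)
    {N : ℕ → ℕ} (hN : Tendsto N atTop atTop) {n₀ : ℕ → Fin k → ℕ}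
    (hn₀ : ∀ m j, |(n₀ m j : ℝ) - N m * lam₀ j| < 1)
    {Ω : ℕ → Type*} [∀ m, MeasurableSpace (Ω m)] {P : (m : ℕ) → Measure (Ω m)}
    [∀ m, IsProbabilityMeasure (P m)] {X : (m : ℕ) → ℕ → Ω m → Vec p}
    (hX : ∀ m, M.IsSample (P m) (N m) (n₀ m) (X m))
    (hdiff : M.NeighboursDiffer) (hsmooth : M.SmoothLogLik) (hblock : M.BlockMoments P N X)
    {nhat : (m : ℕ) → Ω m → Fin k → ℕ} {ψhat : (m : ℕ) → Ω m → Vec d}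
    {θhat : (m : ℕ) → Ω m → (j : Fin (k + 1)) → Vec (dθ j)}
    (hML : ∀ m, ∀ᵐ ω ∂P m,
      M.IsMLE (N m) (fun i => X m i ω) (nhat m ω) (ψhat m ω) (θhat m ω))
    {η : ENNReal} (hη : 0 < η) :
    ∃ K : ℝ, 0 ≤ K ∧ ∀ m, P m {ω | ∃ q, K < |(nhat m ω q : ℝ) - n₀ m q|} ≤ η := by
  obtain ⟨hint, C, r, hr, hmom⟩ := hblock
  have hintM : M.IntegrableLog := (hX 0).integrableLog (hint 0)
  obtain ⟨κ, hκ, hsep⟩ := M.exists_separation hintM hsmooth hdiff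
  obtain ⟨ρ, hρ, hgap⟩ := exists_forall_segment_length hlam_mono hlam hN hn₀
  -- The first bound keeps the local noise below the drift. The second keeps the global noise, with
  -- `2 ^ m₀ ≤ N m`, below `κ / 8 * (ρ * N m)`.
  set ε : ℝ := min (κ / (8 * (k + 1))) (κ * ρ / (64 * (k + 1))) with hε
  have hεpos : 0 < ε := by positivity
  have hε1 : ε * (8 * (k + 1)) ≤ κ := by
    rw [← le_div_iff₀ (by positivity)]; exact min_le_left _ _
  have hε2 : ε * (64 * (k + 1)) ≤ κ * ρ := by
    rw [← le_div_iff₀ (by positivity)]; exact min_le_right _ _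
  -- Raising the exponent to at least `3 / 2` is harmless, since block lengths are at least 1 and it
  -- stays below 2.
  obtain ⟨m₀, hm₀⟩ : ∃ m₀ : ℕ, ((k : ENNReal) + 1) * ((k + 2) * (2 * (40 * ENNReal.ofReal (max C 0)
      / ENNReal.ofReal ε ^ 2 * (1 - 2 ^ (max r (3 / 2)) / 4)⁻¹
      * (2 ^ (max r (3 / 2)) / 4) ^ m₀))) ≤ η := by
    have h := tendsto_hajekRenyi_bound (C := ENNReal.ofReal (max C 0))
      (max_lt hr (by norm_num : (3 / 2 : ℝ) < 2)) ENNReal.ofReal_ne_top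
      (ε := ENNReal.ofReal ε) (by simpa using hεpos)
    have h1 := ENNReal.Tendsto.const_mul (a := 2) h (Or.inr (by norm_num))
    have h2 := ENNReal.Tendsto.const_mul (a := (k : ENNReal) + 2) h1 (Or.inr (by finiteness))
    have h3 := ENNReal.Tendsto.const_mul (a := (k : ENNReal) + 1) h2 (Or.inr (by finiteness))
    simp only [mul_zero] at h3
    exact ((h3.eventually_lt_const hη).exists).imp fun _ h => h.le
  have hlarge : ∀ᶠ m in atTop, (2 : ℝ) ^ m₀ ≤ N m :=
    (tendsto_natCast_atTop_atTop.comp hN).eventually_ge_atTop _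
  obtain ⟨m₁, hm₁⟩ := eventually_atTop.1 (hgap.and hlarge)
  -- The finitely many samples before `m₁` are absorbed into the constant: their errors almost
  -- surely do not exceed `N m`.
  refine ⟨2 ^ m₀ + ∑ m ∈ Finset.range m₁, (N m : ℝ), by positivity, fun m => ?_⟩
  have hsum : (0 : ℝ) ≤ ∑ m ∈ Finset.range m₁, (N m : ℝ) := by positivity
  rcases le_or_gt m₁ m with hm | hm
  · obtain ⟨⟨R, hR, hRN, hgapR⟩, hNm⟩ := hm₁ m hm
    refine le_trans (measure_mono ?_) (((hX m).measure_lt_abs_sub_le hsmooth hintM (hint m)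
      (le_max_right C 0) (le_max_right r (3 / 2)) (fun j s t hst ht => ?_) hκ hsep hR hgapR hεpos
      hε1 (m₀ := m₀) ?_ (hML m)).trans hm₀)
    · rintro ω ⟨q, hq⟩
      exact ⟨q, by linarith⟩
    · refine (hmom m j s t hst ht).trans (ENNReal.ofReal_le_ofReal ?_)
      have h1 : (1 : ℝ) ≤ (t : ℝ) - s := by
        have : (s : ℝ) + 1 ≤ t := by exact_mod_cast hst
        linarith
      exact mul_le_mul (le_max_left _ _)
        (Real.rpow_le_rpow_of_exponent_le h1 (le_max_left _ _)) (by positivity) (le_max_right _ _)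
    · have hk : (0 : ℝ) < k + 1 := by positivity
      have h1 : ε * (N m + 2 ^ m₀) ≤ ε * (2 * N m) := by
        gcongr
        linarith
      calc 4 * ((k : ℝ) + 1) * (ε * (N m + 2 ^ m₀)) ≤ 4 * ((k : ℝ) + 1) * (ε * (2 * N m)) := by
            gcongr
        _ = ε * (64 * (k + 1)) / 8 * N m := by ring
        _ ≤ κ * ρ / 8 * N m := by gcongr
        _ = κ / 8 * (ρ * N m) := by ring
        _ ≤ κ / 8 * R := by gcongr
  · refine le_trans (le_of_eq ?_) zero_le
    rw [measure_eq_zero_iff_ae_notMem]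
    filter_upwards [hML m] with ω hω ⟨q, hq⟩
    refine hq.not_ge ?_
    have h1 : (nhat m ω q : ℝ) ≤ N m := by exact_mod_cast hω.isConfiguration.apply_le q
    have h2 : (n₀ m q : ℝ) ≤ N m := by exact_mod_cast (hX m).isConfiguration.apply_le q
    have h3 : (N m : ℝ) ≤ ∑ m ∈ Finset.range m₁, (N m : ℝ) :=
      Finset.single_le_sum (f := fun m => (N m : ℝ)) (fun _ _ => Nat.cast_nonneg _)
        (Finset.mem_range.2 hm)
    have h4 : (0 : ℝ) < 2 ^ m₀ := by positivity
    have h5 : (0 : ℝ) ≤ nhat m ω q := Nat.cast_nonneg _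
    have h6 : (0 : ℝ) ≤ n₀ m q := Nat.cast_nonneg _
    rw [abs_le]
    constructor <;> linarith

end ChangePoint

/-! ### From tightness to the three forms of the rate -/

theorem theorem2 {k p d : ℕ} {dθ : Fin (k + 1) → ℕ} (M : ChangePoint.Model k p d dθ)
    -- true change-point fractions
    (lam₀ : Fin k → ℝ) (hlam_mono : StrictMono lam₀) (hlam : ∀ j, 0 < lam₀ j ∧ lam₀ j < 1)
    -- sample sizes and true change points (the fractions are fixed, up to rounding)
    (N : ℕ → ℕ) (hN : Tendsto N atTop atTop) (n₀ : ℕ → Fin k → ℕ)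
    (hn₀ : ∀ m j, |(n₀ m j : ℝ) - N m * lam₀ j| < 1)
    -- the samples
    {Ω : ℕ → Type*} [∀ m, MeasurableSpace (Ω m)] (P : (m : ℕ) → Measure (Ω m))
    [∀ m, IsProbabilityMeasure (P m)] (X : (m : ℕ) → ℕ → Ω m → ChangePoint.Vec p)
    (hX : ∀ m, M.IsSample (P m) (N m) (n₀ m) (X m))
    -- the assumptions
    (hdiff : M.NeighboursDiffer) (hcompact : M.CompactParameters) (hsmooth : M.SmoothLogLik)
    (hblock : M.BlockMoments P N X) (hwithin : M.WithinSegmentMoments P N n₀ X)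
    -- maximum likelihood estimators
    (nhat : (m : ℕ) → Ω m → Fin k → ℕ) (ψhat : (m : ℕ) → Ω m → ChangePoint.Vec d)
    (θhat : (m : ℕ) → Ω m → (j : Fin (k + 1)) → ChangePoint.Vec (dθ j))
    (hML : ∀ m, ∀ᵐ ω ∂P m,
      M.IsMLE (N m) (fun i => X m i ω) (nhat m ω) (ψhat m ω) (θhat m ω)) :
    Tendsto (fun δ : ℝ => limsup (fun m =>
        P m {ω | δ ≤ N m * ‖(fun j => (nhat m ω j : ℝ) / N m) - lam₀‖}) atTop) atTop (𝓝 0) ∧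
      (∀ j, ChangePoint.IsBigOInProb P
        (fun m ω => (nhat m ω j : ℝ) / N m - lam₀ j) (fun m => (N m : ℝ)⁻¹)) ∧
      (∀ j, ChangePoint.IsBigOInProb P
        (fun m ω => (nhat m ω j : ℝ) - n₀ m j) (fun _ => 1)) := by
  have htight := fun (η : ENNReal) (hη : 0 < η) =>
    ChangePoint.exists_forall_measure_lt_abs_sub_le M hlam_mono hlam hN hn₀ hX hdiff hsmooth hblock
      hML hη
  have hNpos : ∀ m, (0 : ℝ) < N m := fun m => by exact_mod_cast (hX m).isConfiguration.pos
  -- The extra 1 is the rounding error of `n₀ m j`; it turns the constant `K` into `K + 1` for the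
  -- fractions.
  have hscale : ∀ m ω j, N m * |(nhat m ω j : ℝ) / N m - lam₀ j|
      ≤ |(nhat m ω j : ℝ) - n₀ m j| + 1 := by
    intro m ω j
    have e : N m * |(nhat m ω j : ℝ) / N m - lam₀ j| = |(nhat m ω j : ℝ) - N m * lam₀ j| := by
      rw [← abs_of_pos (hNpos m), ← abs_mul, abs_of_pos (hNpos m), mul_sub,
        mul_div_cancel₀ _ (hNpos m).ne']
    rw [e]
    exact (abs_sub_le _ (n₀ m j : ℝ) _).trans (by gcongr; exact (hn₀ m j).le)
  refine ⟨?_, fun j ε hε => ?_, fun j ε hε => ?_⟩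
  · rw [ENNReal.tendsto_nhds_zero]
    intro η hη
    obtain ⟨K, hK, h⟩ := htight η hη
    filter_upwards [eventually_gt_atTop (K + 1)] with δ hδ
    refine limsup_le_of_le (by isBoundedDefault) (Eventually.of_forall fun m => ?_)
    refine (measure_mono fun ω hω => ?_).trans (h m)
    by_contra hnot
    simp only [Set.mem_ofPred_eq, not_exists, not_lt] at hnot hω
    have hnorm : ‖(fun j => (nhat m ω j : ℝ) / N m) - lam₀‖ ≤ (K + 1) / N m := by
      refine (pi_norm_le_iff_of_nonneg (by have := hNpos m; positivity)).2 fun j => ?_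
      rw [le_div_iff₀ (hNpos m), mul_comm, Real.norm_eq_abs]
      exact (hscale m ω j).trans (by linarith [hnot j])
    rw [le_div_iff₀ (hNpos m)] at hnorm
    linarith
  · obtain ⟨K, hK, h⟩ := htight (ENNReal.ofReal ε) (by simpa using hε)
    refine ⟨K + 1, fun m => (measure_mono fun ω hω => ?_).trans (h m)⟩
    refine ⟨j, ?_⟩
    simp only [Set.mem_ofPred_eq] at hω
    rw [← div_eq_mul_inv, div_lt_iff₀ (hNpos m), mul_comm] at hω
    linarith [hscale m ω j]
  · obtain ⟨K, hK, h⟩ := htight (ENNReal.ofReal ε) (by simpa using hε)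
    refine ⟨K, fun m => (measure_mono fun ω hω => ?_).trans (h m)⟩
    exact ⟨j, by simpa using hω⟩
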